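/- Let $N\ge 2$ and let $\Omega\subset\mathbb R^N$ be a bounded domain with $C^{1,1}$ boundary $\Gamma=\partial\Omega$: there are $\alpha,\beta>0$ and finitely many rigidly moved Cartesian coordinate systems $y_r=(y_r',y_{rN})$ with functions $\varphi_r\in C^{1,1}(\Delta_r)$, $\Delta_r=\{|y_r'|<\alpha\}$, such that the sets $U_r=\{y_r'\in\Delta_r,\ |y_{rN}-\varphi_r(y_r')|<\beta\}$ cover $\Gamma$, and inside $U_r$ the sets $\Gamma$, $\Omega$ and $\mathbb R^N\setminus\overline\Omega$ are respectively $\{y_{rN}=\varphi_r(y_r')\}$, $\{y_{rN}>\varphi_r(y_r')\}$ and $\{y_{rN}<\varphi_r(y_r')\}$. Fix such a system, and $h_0>0$ such that every ball $B(x;h_0)$ with $x\in\Gamma$ lies in some $U_r$. Let $n$ be the outer unit normal on $\Gamma$, let $d$ be the signed distance to $\Gamma$ (negative in $\Omega$), and set $\Gamma(\delta)=\{x:|d(x)|<\delta\}$. For $\sigma>0$ consider conforming simplicial meshes $\mathcal T_h$ with mesh size $h$, consisting of finitely many closed $N$-simplices $T$ with $h_T=\operatorname{diam}T\le h$ and $h_T\le\sigma\rho_T$,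 where $\rho_T$ is the diameter of the largest ball inscribed in $T$. Let $\overline\Omega_h=\bigcup_{T\in\mathcal T_h}T$, let $\mathcal S_h$ be the set of $(N-1)$-faces of elements of $\mathcal T_h$ that lie in $\partial\overline\Omega_h$, and let $\Gamma_h=\bigcup_{S\in\mathcal S_h}S$. Call $\mathcal T_h$ admissible if $0<h<\min\{h_0,1\}$, all vertices of every $S\in\mathcal S_h$ lie on $\Gamma$, and for each $r$ the set $\Gamma_h\cap U_r$ is the graph $\{y_{rN}=\varphi_{rh}(y_r'),\ y_r'\in\Delta_r\}$ of a continuous function $\varphi_{rh}$. Then the following hold. (a) There is $\delta>0$ such that every $x\in\Gamma(\delta)$ has a unique decomposition $x=\pi(x)+d(x)\,n(\pi(x))$ with $\pi(x)\in\Gamma$; this defines the orthogonal projection $\pi:\Gamma(\delta)\to\Gamma$. (b) There is a constant $C_{0E}>0$, independent of $\sigma$, such that $\sup_{\Delta_r}|\varphi_r-\varphi_{rh}|\le C_{0E}h^2$ for all $r$ and all admissible meshes. (c) Let $\sigma>0$ and let $C_{0E}>0$ be any constant for which the estimate $\sup_{\Delta_r}|\varphi_r-\varphi_{rh}|\le C_{0E}h^2$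 holds for all $r$ and all admissible meshes with regularity constant $\sigma$. Then there is $\bar h>0$ such that, for every such mesh with $h<\bar h$, $\Gamma_h\subset\Gamma(\delta)$ and $\pi|_{\Gamma_h}$ is a homeomorphism from $\Gamma_h$ onto $\Gamma$. Its inverse has the form $x\mapsto x+t^*(x)\,n(x)$, where $t^*:\Gamma\to\mathbb R$ satisfies $|t^*(x)|\le 2C_{0E}h^2$ for all $x\in\Gamma$. -/

import Mathlib

noncomputable section

namespace BoundaryProjection

/-- Euclidean `N`-space. -/
abbrev E (N : ℕ) : Type := EuclideanSpace ℝ (Fin N)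

/-- Local coordinates `y = (y', y_N)`: the Euclidean product of `ℝ^(N-1)` and `ℝ`. -/
abbrev Coord (N : ℕ) : Type := WithLp 2 (E (N - 1) × ℝ)

/-- The local neighbourhood
`U = {x | |y'| < α, φ(y') - β < y_N < φ(y') + β}`, where `y = A x`. -/
def chartNhd {N : ℕ} (A : E N ≃ᵃⁱ[ℝ] Coord N) (φ : E (N - 1) → ℝ) (α β : ℝ) : Set (E N) :=
  {x | (A x).fst ∈ Metric.ball 0 α ∧ φ (A x).fst - β < (A x).snd ∧
    (A x).snd < φ (A x).fst + β}

/-- The graph `{x | |y'| < α, y_N = ψ(y')}`, where `y = A x`. -/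
def chartGraph {N : ℕ} (A : E N ≃ᵃⁱ[ℝ] Coord N) (ψ : E (N - 1) → ℝ) (α : ℝ) : Set (E N) :=
  {x | (A x).fst ∈ Metric.ball 0 α ∧ (A x).snd = ψ (A x).fst}

/-- A finite system of local coordinates exhibiting the boundary of `Ω` as `C^{1,1}`:
near each boundary point, in rigidly moved Cartesian coordinates, the boundary is the graph of
a function `φ r` with Lipschitz gradient on the ball `|y'| < α`, with `Ω` above the graph and the
exterior of `Ω` below it. -/
structure ChartSystem {N : ℕ} (Ω : Set (E N)) where
  M : ℕ
  A : Fin M → (E N ≃ᵃⁱ[ℝ] Coord N)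
  φ : Fin M → E (N - 1) → ℝ
  α : ℝ
  β : ℝ
  α_pos : 0 < α
  β_pos : 0 < β
  differentiableOn : ∀ r, DifferentiableOn ℝ (φ r) (Metric.ball 0 α)
  lipschitz_fderiv : ∀ r, ∃ L : NNReal, LipschitzOnWith L (fderiv ℝ (φ r)) (Metric.ball 0 α)
  cover : frontier Ω ⊆ ⋃ r, chartNhd (A r) (φ r) α β
  boundary_eq : ∀ r, frontier Ω ∩ chartNhd (A r) (φ r) α β = chartGraph (A r) (φ r) α
  inside_eq : ∀ r, Ω ∩ chartNhd (A r) (φ r) α β =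
    {x | (A r x).fst ∈ Metric.ball 0 α ∧ φ r (A r x).fst < (A r x).snd ∧
      (A r x).snd < φ r (A r x).fst + β}
  outside_eq : ∀ r, (closure Ω)ᶜ ∩ chartNhd (A r) (φ r) α β =
    {x | (A r x).fst ∈ Metric.ball 0 α ∧ φ r (A r x).fst - β < (A r x).snd ∧
      (A r x).snd < φ r (A r x).fst}

/-- The coordinate neighbourhood `U_r` of a chart system. -/
def ChartSystem.U {N : ℕ} {Ω : Set (E N)} (c : ChartSystem Ω) (r : Fin c.M) : Set (E N) :=
  chartNhd (c.A r) (c.φ r) c.α c.β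

/-- `h₀` is such that each ball of radius `h₀` about a boundary point lies in some `U_r`. -/
def ChartSystem.IsCoverRadius {N : ℕ} {Ω : Set (E N)} (c : ChartSystem Ω) (h₀ : ℝ) : Prop :=
  0 < h₀ ∧ ∀ x ∈ frontier Ω, ∃ r, Metric.ball x h₀ ⊆ c.U r

open Classical in
/-- Signed distance to the boundary of `Ω`, negative inside `Ω`. -/
def signedDist {N : ℕ} (Ω : Set (E N)) (x : E N) : ℝ :=
  if x ∈ Ω then -Metric.infDist x (frontier Ω) else Metric.infDist x (frontier Ω)

/-- The tubular neighbourhood `Γ(δ) = {x | |d(x)| < δ}`. -/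
def tube {N : ℕ} (Ω : Set (E N)) (δ : ℝ) : Set (E N) := {x | |signedDist Ω x| < δ}

/-- `ν` is the outer unit normal to `Ω` at `x`: `ν` is a unit vector and, for every `ε > 0`, all
`y` close to `x` with `⟪ν, y - x⟫ > ε ‖y - x‖` are exterior to `Ω`, and those with
`⟪ν, y - x⟫ < -ε ‖y - x‖` are in `Ω`. -/
def IsOuterUnitNormal {N : ℕ} (Ω : Set (E N)) (x ν : E N) : Prop :=
  ‖ν‖ = 1 ∧ ∀ ε : ℝ, 0 < ε → ∃ ρ : ℝ, 0 < ρ ∧ ∀ y ∈ Metric.ball x ρ,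
    (ε * ‖y - x‖ < inner ℝ ν (y - x) → y ∉ closure Ω) ∧
    (inner ℝ ν (y - x) < -(ε * ‖y - x‖) → y ∈ Ω)

open Classical in
/-- The outer unit normal field `n`. -/
def outerNormal {N : ℕ} (Ω : Set (E N)) (x : E N) : E N :=
  if h : ∃ ν, IsOuterUnitNormal Ω x ν then h.choose else 0

/-- `p` lies on the boundary and `x = p + d(x) n(p)`. -/
def IsProjection {N : ℕ} (Ω : Set (E N)) (x p : E N) : Prop :=
  p ∈ frontier Ω ∧ x = p + signedDist Ω x • outerNormal Ω p

open Classical in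
/-- The orthogonal projection `π` onto the boundary, `x = π(x) + d(x) n(π(x))`. -/
def proj {N : ℕ} (Ω : Set (E N)) (x : E N) : E N :=
  if h : ∃ p, IsProjection Ω x p then h.choose else x

/-- A conforming simplicial mesh of mesh size `h`; a cell is given by its set of `N + 1`
affinely independent vertices. -/
structure Mesh (N : ℕ) (h : ℝ) where
  cells : Finset (Finset (E N))
  card_eq : ∀ T ∈ cells, T.card = N + 1
  affineIndependent : ∀ T ∈ cells, AffineIndependent ℝ ((↑) : T → E N)
  diam_le : ∀ T ∈ cells, Metric.diam (convexHull ℝ (T : Set (E N))) ≤ h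
  inter_eq : ∀ T ∈ cells, ∀ T' ∈ cells,
    convexHull ℝ (T : Set (E N)) ∩ convexHull ℝ (T' : Set (E N)) =
      convexHull ℝ ((T : Set (E N)) ∩ (T' : Set (E N)))

/-- The diameter `ρ_K` of the largest ball inscribed in `K`. -/
def inscribedDiam {N : ℕ} (K : Set (E N)) : ℝ :=
  sSup {s : ℝ | ∃ (c : E N) (r : ℝ), 0 ≤ r ∧ Metric.closedBall c r ⊆ K ∧ s = 2 * r}

/-- Shape regularity with constant `σ`: `h_T ≤ σ ρ_T` for every cell `T`. -/
def Mesh.IsRegular {N : ℕ} {h : ℝ} (𝒯 : Mesh N h) (σ : ℝ) : Prop :=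
  ∀ T ∈ 𝒯.cells, Metric.diam (convexHull ℝ (T : Set (E N))) ≤
    σ * inscribedDiam (convexHull ℝ (T : Set (E N)))

/-- The closed polyhedral domain `⋃ T`. -/
def Mesh.region {N : ℕ} {h : ℝ} (𝒯 : Mesh N h) : Set (E N) :=
  ⋃ T ∈ 𝒯.cells, convexHull ℝ (T : Set (E N))

/-- The boundary mesh: the `(N-1)`-faces of cells that lie in the boundary of the polyhedral
domain, each given by its set of `N` vertices. -/
def Mesh.boundaryMesh {N : ℕ} {h : ℝ} (𝒯 : Mesh N h) : Set (Finset (E N)) :=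
  {S | S.card = N ∧ (∃ T ∈ 𝒯.cells, S ⊆ T) ∧
    convexHull ℝ (S : Set (E N)) ⊆ frontier 𝒯.region}

/-- The polyhedral boundary `Γ_h`, the union of the elements of the boundary mesh. -/
def Mesh.boundary {N : ℕ} {h : ℝ} (𝒯 : Mesh N h) : Set (E N) :=
  ⋃ S ∈ 𝒯.boundaryMesh, convexHull ℝ (S : Set (E N))

/-- `Γ_h ∩ U_r` is the graph over `Δ_r = {|y'| < α}` of the (continuous) function `ψ`. -/
def Mesh.IsGraphOver {N : ℕ} {h : ℝ} (𝒯 : Mesh N h) {Ω : Set (E N)} (c : ChartSystem Ω)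
    (r : Fin c.M) (ψ : E (N - 1) → ℝ) : Prop :=
  ContinuousOn ψ (Metric.ball 0 c.α) ∧ 𝒯.boundary ∩ c.U r = chartGraph (c.A r) ψ c.α

/-- The mesh is compatible with the chart system: `0 < h < min {h₀, 1}`, inside each `U_r` the
polyhedral boundary is a graph over `Δ_r`, and all vertices of the boundary mesh lie on the
boundary of `Ω`. -/
def Mesh.IsCompatible {N : ℕ} {h : ℝ} (𝒯 : Mesh N h) {Ω : Set (E N)} (c : ChartSystem Ω)
    (h₀ : ℝ) : Prop :=
  0 < h ∧ h < min h₀ 1 ∧ (∀ r, ∃ ψ, 𝒯.IsGraphOver c r ψ) ∧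
    ∀ S ∈ 𝒯.boundaryMesh, (S : Set (E N)) ⊆ frontier Ω

/-- `C` is a constant in the interpolation error estimate
`|φ_r - φ_{rh}| ≤ C h²` on `Δ_r`, for all compatible meshes with regularity constant `σ`. -/
def IsInterpolationConstant {N : ℕ} {Ω : Set (E N)} (c : ChartSystem Ω) (h₀ σ C : ℝ) : Prop :=
  0 < C ∧ ∀ (h : ℝ) (𝒯 : Mesh N h), 𝒯.IsCompatible c h₀ → 𝒯.IsRegular σ →
    ∀ (r : Fin c.M) (ψ : E (N - 1) → ℝ), 𝒯.IsGraphOver c r ψ →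
      ∀ y ∈ Metric.ball (0 : E (N - 1)) c.α, |c.φ r y - ψ y| ≤ C * h ^ 2

end BoundaryProjection

end

/-!
Throughout, `K` bounds the gradients of the graph functions `φ r` and the Lipschitz constants of these
gradients, and `C` is an interpolation constant.

*The boundary.* The outer unit normal at a boundary point is the downward normal of the graph in any
chart containing the point. As each ball of radius `h₀` about a boundary point lies in a chart, the
normal field is Lipschitz, and boundary points `p`, `q` satisfy `|⟪n(p), q - p⟫| ≤ L |q - p|²`
(`ChartSystem.exists_isNormalBound`). The nearest boundary point of `x` is a foot point of `x`,
because the ball about `x` through it does not meet the boundary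
(`ChartSystem.exists_isProjection`). For `|s|, |t| ≤ 1 / (8 L)`, an equality
`p + s n(p) = q + t n(q)` forces `p = q`: the Lipschitz bound gives `|p - q| ≤ |p - q| / 8 + |s - t|`
and the quadratic bound makes `|s - t|` quadratic in `|p - q|`
(`IsNormalBound.eq_of_add_smul_eq`). This gives the tubular neighbourhood.

*The interpolation error.* A face of the polyhedral boundary lies in some chart, where Taylor's
formula puts it at distance at most `K h²` from the boundary. This need not be the chart in which the
error is to be estimated, and near the lateral boundary of that chart the face may protrude.
However, for small `h`, transversality of the boundary to the chart's vertical direction shows that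
the error `|φ - ψ|` at a point is either `O(h²)` or at least a fixed `ρ > 0`
(`ChartSystem.IsBound.abs_sub_le_of_lt`); it is small at the centre, because the face there is
contained in the chart (`Mesh.IsGraphOver.face_subset_U`), so by connectedness it is `O(h²)` on all of
`Δ_r`. No shape regularity is used.

*The projection.* It is Lipschitz continuous, and the polyhedral boundary is compact, so it is enough
that the projection is bijective. It is surjective because, by the intermediate value theorem, the
normal segment of length `2 C h²` on either side of a boundary point crosses the graph of `ψ`. For
injectivity, two points with the same foot point `p` differ by a multiple of `n(p)`, so it is enough
that secants of the polyhedral boundary near `p` are nearly orthogonal to `n(p)`. The edges `v - w` of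
a face of a cell `T` satisfy `⟪n(p), v - w⟫ = O(h h_T)`, and the barycentric coordinates of `T` have
gradients at most `1 / ρ_T ≤ σ / h_T`, so that secants within a face have slope `O(σ h)`
(`Mesh.IsRegular.abs_le_of_edges`). Following the graph of `ψ` over a segment in `Δ_r`, which passes
through finitely many faces, extends this to all secants near `p`
(`ChartSystem.IsBound.abs_inner_le_of_mem_boundary`).
-/

noncomputable section

open Set Metric Filter Topology

namespace BoundaryProjection

variable {N : ℕ} {Ω : Set (E N)}

/-! ### Uniform bounds for the local graph functions -/

/-- `K` bounds the gradients of all the graph functions `φ r`, and is a Lipschitz constant for the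
`φ r` and for their gradients. -/
structure ChartSystem.IsBound (c : ChartSystem Ω) (K : ℝ) : Prop where
  one_le : 1 ≤ K
  norm_fderiv_le : ∀ r, ∀ a ∈ ball (0 : E (N - 1)) c.α, ‖fderiv ℝ (c.φ r) a‖ ≤ K
  fderiv_sub_le : ∀ r, ∀ a ∈ ball (0 : E (N - 1)) c.α, ∀ b ∈ ball (0 : E (N - 1)) c.α,
    ‖fderiv ℝ (c.φ r) a - fderiv ℝ (c.φ r) b‖ ≤ K * ‖a - b‖

theorem ChartSystem.exists_isBound (c : ChartSystem Ω) : ∃ K, c.IsBound K := by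
  choose L hL using c.lipschitz_fderiv
  have h0 : (0 : E (N - 1)) ∈ ball (0 : E (N - 1)) c.α := mem_ball_self c.α_pos
  have hα := c.α_pos
  have hterm : ∀ r, 0 ≤ ‖fderiv ℝ (c.φ r) 0‖ + L r * c.α + L r := fun r => by positivity
  have hle : ∀ r, ‖fderiv ℝ (c.φ r) 0‖ + L r * c.α + L r ≤
      1 + ∑ r, (‖fderiv ℝ (c.φ r) 0‖ + L r * c.α + L r) := fun r =>
    (Finset.single_le_sum (f := fun r => ‖fderiv ℝ (c.φ r) 0‖ + L r * c.α + L r)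
      (fun i _ => hterm i) (Finset.mem_univ r)).trans (le_add_of_nonneg_left zero_le_one)
  refine ⟨1 + ∑ r, (‖fderiv ℝ (c.φ r) 0‖ + L r * c.α + L r),
    le_add_of_nonneg_right (Finset.sum_nonneg fun i _ => hterm i), fun r a ha => ?_,
    fun r a ha b hb => ?_⟩
  · refine le_trans ?_ (hle r)
    have h1 := (hL r).norm_sub_le ha h0
    rw [sub_zero] at h1
    have h2 : ‖a‖ ≤ c.α := (mem_ball_zero_iff.1 ha).le
    have h3 : (L r : ℝ) * ‖a‖ ≤ L r * c.α := by gcongr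
    have h4 := norm_le_norm_add_norm_sub (fderiv ℝ (c.φ r) 0) (fderiv ℝ (c.φ r) a)
    rw [norm_sub_rev] at h4
    have h5 : (0 : ℝ) ≤ L r := (L r).2
    linarith
  · refine ((hL r).norm_sub_le ha hb).trans ?_
    gcongr
    refine le_trans ?_ (hle r)
    have h5 : (0 : ℝ) ≤ L r * c.α := by positivity
    have := norm_nonneg (fderiv ℝ (c.φ r) 0)
    linarith

theorem ChartSystem.differentiableAt (c : ChartSystem Ω) (r : Fin c.M) {a : E (N - 1)}
    (ha : a ∈ ball (0 : E (N - 1)) c.α) : DifferentiableAt ℝ (c.φ r) a :=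
  (c.differentiableOn r).differentiableAt (isOpen_ball.mem_nhds ha)

theorem ChartSystem.IsBound.abs_sub_le {c : ChartSystem Ω} {K : ℝ} (hK : c.IsBound K)
    (r : Fin c.M) {a b : E (N - 1)} (ha : a ∈ ball (0 : E (N - 1)) c.α)
    (hb : b ∈ ball (0 : E (N - 1)) c.α) : |c.φ r b - c.φ r a| ≤ K * ‖b - a‖ :=
  (convex_ball _ _).norm_image_sub_le_of_norm_fderiv_le (fun _ hx => c.differentiableAt r hx)
    (fun x hx => hK.norm_fderiv_le r x hx) ha hb

/-- First order Taylor expansion of the graph functions with a quadratic remainder. -/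
theorem ChartSystem.IsBound.taylor {c : ChartSystem Ω} {K : ℝ} (hK : c.IsBound K)
    (r : Fin c.M) {a b : E (N - 1)} (ha : a ∈ ball (0 : E (N - 1)) c.α)
    (hb : b ∈ ball (0 : E (N - 1)) c.α) :
    |c.φ r b - c.φ r a - fderiv ℝ (c.φ r) a (b - a)| ≤ K * ‖b - a‖ ^ 2 := by
  have hK0 : 0 ≤ K := zero_le_one.trans hK.one_le
  have h := ((convex_ball (0 : E (N - 1)) c.α).inter
    (convex_closedBall a ‖b - a‖)).norm_image_sub_le_of_norm_fderiv_le'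
    (f := c.φ r) (φ := fderiv ℝ (c.φ r) a) (C := K * ‖b - a‖)
    (fun x hx => c.differentiableAt r hx.1)
    (fun x hx => (hK.fderiv_sub_le r x hx.1 a ha).trans
      (mul_le_mul_of_nonneg_left (by simpa [dist_eq_norm] using hx.2) hK0))
    (x := a) (y := b) ⟨ha, mem_closedBall_self (norm_nonneg _)⟩
    ⟨hb, by simp [dist_eq_norm]⟩
  rw [Real.norm_eq_abs] at h
  linarith [h, sq ‖b - a‖, mul_assoc K ‖b - a‖ ‖b - a‖]

/-! ### Chart coordinates -/

theorem fst_chart_sub (A : E N ≃ᵃⁱ[ℝ] Coord N) (x y : E N) :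
    (A.linearIsometryEquiv (x - y)).fst = (A x).fst - (A y).fst := by
  rw [← WithLp.sub_fst]; exact congrArg _ (A.map_vsub x y)

theorem snd_chart_sub (A : E N ≃ᵃⁱ[ℝ] Coord N) (x y : E N) :
    (A.linearIsometryEquiv (x - y)).snd = (A x).snd - (A y).snd := by
  rw [← WithLp.sub_snd]; exact congrArg _ (A.map_vsub x y)

theorem norm_fst_chart_sub_le (A : E N ≃ᵃⁱ[ℝ] Coord N) (x y : E N) :
    ‖(A x).fst - (A y).fst‖ ≤ ‖x - y‖ := by
  rw [← fst_chart_sub, ← A.linearIsometryEquiv.norm_map (x - y)]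
  exact WithLp.norm_fst_le (α := E (N - 1)) (β := ℝ) (x := _)

theorem abs_snd_chart_sub_le (A : E N ≃ᵃⁱ[ℝ] Coord N) (x y : E N) :
    |(A x).snd - (A y).snd| ≤ ‖x - y‖ := by
  rw [← snd_chart_sub, ← A.linearIsometryEquiv.norm_map (x - y)]
  exact WithLp.norm_snd_le (α := E (N - 1)) (β := ℝ) (x := _)

theorem norm_sub_le_chart (A : E N ≃ᵃⁱ[ℝ] Coord N) (x y : E N) :
    ‖x - y‖ ≤ ‖(A x).fst - (A y).fst‖ + |(A x).snd - (A y).snd| := by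
  rw [← fst_chart_sub, ← snd_chart_sub, ← A.linearIsometryEquiv.norm_map (x - y)]
  generalize A.linearIsometryEquiv (x - y) = w
  have h := WithLp.prod_norm_sq_eq_of_L2 w
  rw [Real.norm_eq_abs] at h
  refine le_of_sq_le_sq ?_ (by positivity)
  nlinarith [mul_nonneg (norm_nonneg w.fst) (abs_nonneg w.snd)]

theorem continuous_fst_chart (A : E N ≃ᵃⁱ[ℝ] Coord N) : Continuous fun x => (A x).fst :=
  (WithLp.continuous_fst 2 _ _).comp A.continuous

theorem continuous_snd_chart (A : E N ≃ᵃⁱ[ℝ] Coord N) : Continuous fun x => (A x).snd :=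
  (WithLp.continuous_snd 2 _ _).comp A.continuous

theorem ChartSystem.continuousOn (c : ChartSystem Ω) (r : Fin c.M) :
    ContinuousOn (c.φ r) (ball 0 c.α) := (c.differentiableOn r).continuousOn

theorem ChartSystem.isOpen_U (c : ChartSystem Ω) (r : Fin c.M) : IsOpen (c.U r) := by
  have h1 : IsOpen {x : E N | (c.A r x).fst ∈ ball (0 : E (N - 1)) c.α} :=
    isOpen_ball.preimage (continuous_fst_chart _)
  have h2 : ContinuousOn (fun x => (c.A r x).snd - c.φ r (c.A r x).fst)
      {x : E N | (c.A r x).fst ∈ ball (0 : E (N - 1)) c.α} :=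
    (continuous_snd_chart _).continuousOn.sub
      ((c.continuousOn r).comp (continuous_fst_chart _).continuousOn fun x hx => hx)
  convert h2.isOpen_inter_preimage h1 (isOpen_Ioo (a := -c.β) (b := c.β)) using 1
  ext x
  simp only [ChartSystem.U, chartNhd, mem_ofPred_eq, mem_inter_iff, mem_preimage, mem_Ioo]
  constructor <;> rintro ⟨h, h', h''⟩ <;> exact ⟨h, by linarith, by linarith⟩

theorem ChartSystem.mem_frontier_iff (c : ChartSystem Ω) (r : Fin c.M) {x : E N}
    (hx : x ∈ c.U r) : x ∈ frontier Ω ↔ (c.A r x).snd = c.φ r (c.A r x).fst := by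
  have h := c.boundary_eq r
  refine ⟨fun h' => ?_, fun h' => ?_⟩
  · exact (h.subset ⟨h', hx⟩).2
  · exact (h.superset ⟨hx.1, h'⟩).1

theorem ChartSystem.mem_of_mem_U (c : ChartSystem Ω) (r : Fin c.M) {x : E N}
    (hx : x ∈ c.U r) (h : c.φ r (c.A r x).fst < (c.A r x).snd) : x ∈ Ω :=
  ((c.inside_eq r).superset ⟨hx.1, h, hx.2.2⟩).1

theorem ChartSystem.notMem_closure_of_mem_U (c : ChartSystem Ω) (r : Fin c.M) {x : E N}
    (hx : x ∈ c.U r) (h : (c.A r x).snd < c.φ r (c.A r x).fst) : x ∉ closure Ω :=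
  ((c.outside_eq r).superset ⟨hx.1, hx.2.1, h⟩).1

/-- The point with chart coordinates `(y, s)`. -/
def chartPoint (A : E N ≃ᵃⁱ[ℝ] Coord N) (y : E (N - 1)) (s : ℝ) : E N :=
  A.symm (WithLp.toLp 2 (y, s))

@[simp] theorem fst_chartPoint (A : E N ≃ᵃⁱ[ℝ] Coord N) (y : E (N - 1)) (s : ℝ) :
    (A (chartPoint A y s)).fst = y := by simp [chartPoint]

@[simp] theorem snd_chartPoint (A : E N ≃ᵃⁱ[ℝ] Coord N) (y : E (N - 1)) (s : ℝ) :
    (A (chartPoint A y s)).snd = s := by simp [chartPoint]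

theorem eq_of_chart_eq (A : E N ≃ᵃⁱ[ℝ] Coord N) {x y : E N} (h1 : (A x).fst = (A y).fst)
    (h2 : (A x).snd = (A y).snd) : x = y := by
  have h := norm_sub_le_chart A x y
  rw [h1, h2, sub_self, sub_self, norm_zero, abs_zero, add_zero] at h
  exact sub_eq_zero.1 (norm_le_zero_iff.1 h)

theorem ChartSystem.chartPoint_mem_frontier (c : ChartSystem Ω) (r : Fin c.M) {y : E (N - 1)}
    (hy : y ∈ ball (0 : E (N - 1)) c.α) : chartPoint (c.A r) y (c.φ r y) ∈ frontier Ω :=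
  ((c.boundary_eq r).superset ⟨by simpa using hy, by simp⟩).1

theorem ChartSystem.chartPoint_mem_U (c : ChartSystem Ω) (r : Fin c.M) {y : E (N - 1)}
    (hy : y ∈ ball (0 : E (N - 1)) c.α) : chartPoint (c.A r) y (c.φ r y) ∈ c.U r :=
  ((c.boundary_eq r).superset ⟨by simpa using hy, by simp⟩).2

/-! ### The outer unit normal -/

/-- The outer unit normal is unique: if `ν ≠ ν'` were two of them, the points `x + s (ν - ν')` with
`s > 0` small would be both exterior to `Ω` and in `Ω`. -/
theorem IsOuterUnitNormal.unique {x ν ν' : E N} (h : IsOuterUnitNormal Ω x ν)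
    (h' : IsOuterUnitNormal Ω x ν') : ν = ν' := by
  by_contra hne
  set u := ν - ν' with hu
  have hu0 : 0 < ‖u‖ := norm_pos_iff.2 (sub_ne_zero.2 hne)
  have hsq : ‖u‖ ^ 2 = 2 - 2 * inner ℝ ν ν' := by
    rw [hu, norm_sub_sq_real, h.1, h'.1]; ring
  have h1 : inner ℝ ν u = ‖u‖ ^ 2 / 2 := by
    rw [hsq, hu, inner_sub_right, real_inner_self_eq_norm_sq, h.1]; ring
  have h2 : inner ℝ ν' u = -(‖u‖ ^ 2 / 2) := by
    rw [hsq, hu, inner_sub_right, real_inner_self_eq_norm_sq, h'.1, real_inner_comm]; ring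
  obtain ⟨ρ, hρ, H⟩ := h.2 (‖u‖ / 4) (by positivity)
  obtain ⟨ρ', hρ', H'⟩ := h'.2 (‖u‖ / 4) (by positivity)
  obtain ⟨s, hs0, hs⟩ := exists_between (show 0 < min ρ ρ' / ‖u‖ by positivity)
  rw [lt_div_iff₀ hu0] at hs
  have hnorm : ‖x + s • u - x‖ = s * ‖u‖ := by
    rw [add_sub_cancel_left, norm_smul, Real.norm_of_nonneg hs0.le]
  have hy : x + s • u ∈ ball x ρ := by
    rw [mem_ball, dist_eq_norm, hnorm]; exact hs.trans_le (min_le_left _ _)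
  have hy' : x + s • u ∈ ball x ρ' := by
    rw [mem_ball, dist_eq_norm, hnorm]; exact hs.trans_le (min_le_right _ _)
  have hpos : 0 < s * ‖u‖ ^ 2 := by positivity
  refine (H _ hy).1 ?_ (subset_closure ((H' _ hy').2 ?_))
  · rw [hnorm, add_sub_cancel_left, inner_smul_right, h1]; nlinarith
  · rw [hnorm, add_sub_cancel_left, inner_smul_right, h2]; nlinarith

theorem outerNormal_eq {x ν : E N} (h : IsOuterUnitNormal Ω x ν) : outerNormal Ω x = ν := by
  have hex : ∃ ν, IsOuterUnitNormal Ω x ν := ⟨ν, h⟩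
  rw [outerNormal, dif_pos hex]
  exact hex.choose_spec.unique h

/-- The downward normal `(D, -1)` to a graph with differential `D`, in chart coordinates. -/
def graphNormal (D : E (N - 1) →L[ℝ] ℝ) : Coord N :=
  WithLp.toLp 2 ((InnerProductSpace.toDual ℝ (E (N - 1))).symm D, -1)

theorem inner_graphNormal (D : E (N - 1) →L[ℝ] ℝ) (w : Coord N) :
    inner ℝ (graphNormal D) w = D w.fst - w.snd := by
  simp [graphNormal, WithLp.prod_inner_apply]
  ring

theorem norm_graphNormal_sq (D : E (N - 1) →L[ℝ] ℝ) :
    ‖graphNormal D‖ ^ 2 = ‖D‖ ^ 2 + 1 := by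
  simp [graphNormal, WithLp.prod_norm_sq_eq_of_L2]

theorem one_le_norm_graphNormal (D : E (N - 1) →L[ℝ] ℝ) : 1 ≤ ‖graphNormal D‖ := by
  have := norm_graphNormal_sq D
  nlinarith [norm_nonneg (graphNormal D), sq_nonneg ‖D‖]

theorem norm_graphNormal_le (D : E (N - 1) →L[ℝ] ℝ) : ‖graphNormal D‖ ≤ 1 + ‖D‖ := by
  have := norm_graphNormal_sq D
  refine le_of_sq_le_sq ?_ (by positivity)
  nlinarith [norm_nonneg D]

theorem norm_graphNormal_sub (D D' : E (N - 1) →L[ℝ] ℝ) :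
    ‖graphNormal D - graphNormal D'‖ = ‖D - D'‖ := by
  rw [graphNormal, graphNormal, ← WithLp.toLp_sub, Prod.mk_sub_mk, sub_self,
    WithLp.norm_toLp_fst, ← map_sub, LinearIsometryEquiv.norm_map]

/-- Normalization is Lipschitz away from the open unit ball. -/
theorem norm_normalize_sub_le {V : Type*} [NormedAddCommGroup V] [NormedSpace ℝ V] {a b : V}
    (ha : 1 ≤ ‖a‖) (hb : 1 ≤ ‖b‖) : ‖‖a‖⁻¹ • a - ‖b‖⁻¹ • b‖ ≤ 2 * ‖a - b‖ := by
  have ha0 : 0 < ‖a‖ := by linarith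
  have hb0 : 0 < ‖b‖ := by linarith
  have h : ‖a‖⁻¹ • a - ‖b‖⁻¹ • b = ‖a‖⁻¹ • (a - b) + (‖a‖⁻¹ - ‖b‖⁻¹) • b := by
    rw [smul_sub, sub_smul]; abel
  have h1 : ‖‖a‖⁻¹ • (a - b)‖ ≤ ‖a - b‖ := by
    rw [norm_smul, norm_inv, norm_norm]
    exact mul_le_of_le_one_left (norm_nonneg _) (inv_le_one_of_one_le₀ ha)
  have h2 : ‖(‖a‖⁻¹ - ‖b‖⁻¹) • b‖ ≤ ‖a - b‖ := by
    rw [norm_smul, Real.norm_eq_abs, inv_sub_inv ha0.ne' hb0.ne', abs_div,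
      abs_of_pos (mul_pos ha0 hb0), div_mul_eq_mul_div, mul_div_mul_right _ _ hb0.ne']
    rw [abs_sub_comm]
    exact (div_le_self (abs_nonneg _) ha).trans (abs_norm_sub_norm_le a b)
  rw [h]
  linarith [norm_add_le (‖a‖⁻¹ • (a - b)) ((‖a‖⁻¹ - ‖b‖⁻¹) • b)]

/-- The unit normal at `p` pointing below the graph of `c.φ r`. -/
def ChartSystem.normal (c : ChartSystem Ω) (r : Fin c.M) (p : E N) : E N :=
  ‖graphNormal (fderiv ℝ (c.φ r) (c.A r p).fst)‖⁻¹ •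
    (c.A r).linearIsometryEquiv.symm (graphNormal (fderiv ℝ (c.φ r) (c.A r p).fst))

theorem ChartSystem.norm_normal (c : ChartSystem Ω) (r : Fin c.M) (p : E N) :
    ‖c.normal r p‖ = 1 := by
  have h := one_le_norm_graphNormal (fderiv ℝ (c.φ r) (c.A r p).fst)
  rw [ChartSystem.normal, norm_smul, LinearIsometryEquiv.norm_map, norm_inv, norm_norm,
    inv_mul_cancel₀ (by linarith)]

theorem ChartSystem.inner_normal (c : ChartSystem Ω) (r : Fin c.M) (p x y : E N) :
    ‖graphNormal (fderiv ℝ (c.φ r) (c.A r p).fst)‖ * inner ℝ (c.normal r p) (x - y) =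
      fderiv ℝ (c.φ r) (c.A r p).fst ((c.A r x).fst - (c.A r y).fst) -
        ((c.A r x).snd - (c.A r y).snd) := by
  have h := one_le_norm_graphNormal (fderiv ℝ (c.φ r) (c.A r p).fst)
  rw [ChartSystem.normal, real_inner_smul_left, mul_inv_cancel_left₀ (by linarith),
    ← fst_chart_sub, ← snd_chart_sub, ← inner_graphNormal,
    ← (c.A r).linearIsometryEquiv.inner_map_map, LinearIsometryEquiv.apply_symm_apply]

theorem ChartSystem.IsBound.isOuterUnitNormal {c : ChartSystem Ω} {K : ℝ} (hK : c.IsBound K)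
    (r : Fin c.M) {p : E N} (hp : p ∈ frontier Ω) (hpU : p ∈ c.U r) :
    IsOuterUnitNormal Ω p (c.normal r p) := by
  have hK0 : 0 < K := zero_lt_one.trans_le hK.one_le
  refine ⟨c.norm_normal r p, fun ε hε => ?_⟩
  obtain ⟨ρ, hρ, hball⟩ := Metric.isOpen_iff.1 (c.isOpen_U r) p hpU
  refine ⟨min ρ (ε / K), by positivity, fun y hy => ?_⟩
  have hyU : y ∈ c.U r := hball (ball_subset_ball (min_le_left _ _) hy)
  have hy2 : ‖y - p‖ < ε / K :=
    (dist_eq_norm y p ▸ mem_ball.1 hy : ‖y - p‖ < _).trans_le (min_le_right _ _)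
  rw [lt_div_iff₀ hK0] at hy2
  have hp' := (c.mem_frontier_iff r hpU).1 hp
  have hT := abs_le.1 (hK.taylor r hpU.1 hyU.1)
  have hI := c.inner_normal r p y p
  have h1 := one_le_norm_graphNormal (fderiv ℝ (c.φ r) (c.A r p).fst)
  have hle := norm_fst_chart_sub_le (c.A r) y p
  have hrem : K * ‖(c.A r y).fst - (c.A r p).fst‖ ^ 2 ≤ ε * ‖y - p‖ := by
    have : ‖(c.A r y).fst - (c.A r p).fst‖ ^ 2 ≤ ‖y - p‖ ^ 2 := by gcongr
    nlinarith [norm_nonneg (y - p)]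
  have hεn : 0 ≤ ε * ‖y - p‖ := by positivity
  constructor
  · intro h
    apply c.notMem_closure_of_mem_U r hyU
    have : ε * ‖y - p‖ < ‖graphNormal (fderiv ℝ (c.φ r) (c.A r p).fst)‖ *
        inner ℝ (c.normal r p) (y - p) := by nlinarith
    linarith [hT.1]
  · intro h
    apply c.mem_of_mem_U r hyU
    have : ‖graphNormal (fderiv ℝ (c.φ r) (c.A r p).fst)‖ *
        inner ℝ (c.normal r p) (y - p) < -(ε * ‖y - p‖) := by nlinarith
    linarith [hT.2]

theorem ChartSystem.outerNormal_eq (c : ChartSystem Ω) (r : Fin c.M) {p : E N}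
    (hp : p ∈ frontier Ω) (hpU : p ∈ c.U r) : outerNormal Ω p = c.normal r p := by
  obtain ⟨K, hK⟩ := c.exists_isBound
  exact BoundaryProjection.outerNormal_eq (hK.isOuterUnitNormal r hp hpU)

theorem ChartSystem.isOuterUnitNormal_outerNormal (c : ChartSystem Ω) {p : E N}
    (hp : p ∈ frontier Ω) : IsOuterUnitNormal Ω p (outerNormal Ω p) := by
  obtain ⟨r, hr⟩ := mem_iUnion.1 (c.cover hp)
  obtain ⟨K, hK⟩ := c.exists_isBound
  rw [c.outerNormal_eq r hp hr]
  exact hK.isOuterUnitNormal r hp hr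

theorem ChartSystem.norm_outerNormal (c : ChartSystem Ω) {p : E N}
    (hp : p ∈ frontier Ω) : ‖outerNormal Ω p‖ = 1 := (c.isOuterUnitNormal_outerNormal hp).1

/-- The boundary is transversal to the vertical direction of a chart: a vector nearly orthogonal to
the normal is controlled by its horizontal part. -/
theorem ChartSystem.IsBound.abs_snd_le {c : ChartSystem Ω} {K : ℝ} (hK : c.IsBound K)
    (r : Fin c.M) {p : E N} (hp : p ∈ frontier Ω) (hpU : p ∈ c.U r) (x y : E N) :
    |(c.A r x).snd - (c.A r y).snd| ≤
      (1 + K) * (‖(c.A r x).fst - (c.A r y).fst‖ + |inner ℝ (outerNormal Ω p) (x - y)|) := by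
  rw [c.outerNormal_eq r hp hpU]
  have hI := c.inner_normal r p x y
  have hD := hK.norm_fderiv_le r _ hpU.1
  set D := fderiv ℝ (c.φ r) (c.A r p).fst
  set i := inner ℝ (c.normal r p) (x - y)
  set w := (c.A r x).fst - (c.A r y).fst
  have h1 : |D w| ≤ K * ‖w‖ := (D.le_opNorm w).trans (by gcongr)
  have h2 : |‖graphNormal D‖ * i| ≤ (1 + K) * |i| := by
    rw [abs_mul, abs_norm]
    gcongr
    exact (norm_graphNormal_le D).trans (by linarith)
  have h3 : (c.A r x).snd - (c.A r y).snd = D w - ‖graphNormal D‖ * i := by linarith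
  rw [h3]
  have := abs_sub (D w) (‖graphNormal D‖ * i)
  nlinarith [norm_nonneg w]

/-- Quantitative `C^{1,1}` regularity of the boundary, expressed by the outer normals. -/
structure IsNormalBound (Ω : Set (E N)) (L : ℝ) : Prop where
  one_le : 1 ≤ L
  norm_sub_le : ∀ p ∈ frontier Ω, ∀ q ∈ frontier Ω,
    ‖outerNormal Ω p - outerNormal Ω q‖ ≤ L * ‖p - q‖
  abs_inner_le : ∀ p ∈ frontier Ω, ∀ q ∈ frontier Ω,
    |inner ℝ (outerNormal Ω p) (q - p)| ≤ L * ‖q - p‖ ^ 2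

theorem ChartSystem.exists_isNormalBound (c : ChartSystem Ω) {h₀ : ℝ} (hh₀ : c.IsCoverRadius h₀) :
    ∃ L, IsNormalBound Ω L := by
  obtain ⟨K, hK⟩ := c.exists_isBound
  have hK1 := hK.one_le
  have hK0 : 0 < K := by linarith
  obtain ⟨h0, hball⟩ := hh₀
  have hinv : 0 < 1 / h₀ := by positivity
  have hL1 : 2 * K ≤ 2 * K + 2 / h₀ := le_add_of_nonneg_right (by positivity)
  have hL2 : 2 / h₀ ≤ 2 * K + 2 / h₀ := le_add_of_nonneg_left (by positivity)
  refine ⟨2 * K + 2 / h₀, by linarith, fun p hp q hq => ?_, fun p hp q hq => ?_⟩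
  · rcases lt_or_ge ‖p - q‖ h₀ with hlt | hge
    · obtain ⟨r, hr⟩ := hball q hq
      have hqU := hr (mem_ball_self h0)
      have hpU := hr (mem_ball.2 (dist_eq_norm p q ▸ hlt))
      rw [c.outerNormal_eq r hp hpU, c.outerNormal_eq r hq hqU, ChartSystem.normal,
        ChartSystem.normal, ← map_smul, ← map_smul, ← map_sub, LinearIsometryEquiv.norm_map]
      refine (norm_normalize_sub_le (one_le_norm_graphNormal _)
        (one_le_norm_graphNormal _)).trans ?_
      rw [norm_graphNormal_sub]
      have h1 := hK.fderiv_sub_le r _ hpU.1 _ hqU.1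
      have h2 := norm_fst_chart_sub_le (c.A r) p q
      calc _ ≤ 2 * (K * ‖p - q‖) := by gcongr; exact h1.trans (by gcongr)
        _ = 2 * K * ‖p - q‖ := by ring
        _ ≤ _ := by gcongr
    · have h1 := norm_sub_le (outerNormal Ω p) (outerNormal Ω q)
      rw [c.norm_outerNormal hp, c.norm_outerNormal hq] at h1
      calc _ ≤ (2 : ℝ) := by linarith
        _ = 2 / h₀ * h₀ := by field_simp
        _ ≤ _ := by gcongr
  · rcases lt_or_ge ‖q - p‖ h₀ with hlt | hge
    · obtain ⟨r, hr⟩ := hball p hp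
      have hpU := hr (mem_ball_self h0)
      have hqU := hr (mem_ball.2 (dist_eq_norm q p ▸ hlt))
      have hI := c.inner_normal r p q p
      have hT := hK.taylor r hpU.1 hqU.1
      have h2 := norm_fst_chart_sub_le (c.A r) q p
      rw [c.outerNormal_eq r hp hpU]
      rw [(c.mem_frontier_iff r hqU).1 hq, (c.mem_frontier_iff r hpU).1 hp] at hI
      have h1 := one_le_norm_graphNormal (fderiv ℝ (c.φ r) (c.A r p).fst)
      calc _ ≤ ‖graphNormal (fderiv ℝ (c.φ r) (c.A r p).fst)‖ *
            |inner ℝ (c.normal r p) (q - p)| := le_mul_of_one_le_left (abs_nonneg _) h1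
        _ = |‖graphNormal (fderiv ℝ (c.φ r) (c.A r p).fst)‖ *
            inner ℝ (c.normal r p) (q - p)| := by rw [abs_mul, abs_norm]
        _ ≤ K * ‖(c.A r q).fst - (c.A r p).fst‖ ^ 2 := by
            rw [hI, abs_sub_comm]; exact hT
        _ ≤ (2 * K + 2 / h₀) * ‖q - p‖ ^ 2 := by gcongr; linarith
    · have h1 := abs_real_inner_le_norm (outerNormal Ω p) (q - p)
      rw [c.norm_outerNormal hp, one_mul] at h1
      calc _ ≤ 1 * ‖q - p‖ := by linarith
        _ ≤ (2 / h₀ * ‖q - p‖) * ‖q - p‖ := by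
            gcongr
            calc (1 : ℝ) ≤ 2 := by norm_num
              _ = 2 / h₀ * h₀ := by field_simp
              _ ≤ _ := by gcongr
        _ = 2 / h₀ * ‖q - p‖ ^ 2 := by ring
        _ ≤ _ := by gcongr

/-! ### The tubular neighbourhood -/

theorem nonempty_frontier_of_isBounded (hN : 2 ≤ N) (hne : Ω.Nonempty)
    (hb : Bornology.IsBounded Ω) : (frontier Ω).Nonempty := by
  have : Nonempty (Fin N) := ⟨⟨0, by omega⟩⟩
  rw [nonempty_frontier_iff]
  refine ⟨hne, fun h => ?_⟩
  rw [h] at hb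
  exact NormedSpace.unbounded_univ ℝ (E N) hb

theorem isCompact_frontier_of_isBounded (hb : Bornology.IsBounded Ω) : IsCompact (frontier Ω) :=
  isCompact_of_isClosed_isBounded isClosed_frontier (hb.closure.subset frontier_subset_closure)

theorem abs_signedDist (Ω : Set (E N)) (x : E N) :
    |signedDist Ω x| = infDist x (frontier Ω) := by
  rw [signedDist]
  split_ifs
  · rw [abs_neg, abs_of_nonneg infDist_nonneg]
  · rw [abs_of_nonneg infDist_nonneg]

theorem inter_frontier_nonempty_of_isPreconnected {X : Type*} [TopologicalSpace X] {s t : Set X}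
    (ht : IsPreconnected t) (h1 : (t ∩ s).Nonempty) (h2 : (t ∩ sᶜ).Nonempty) :
    (t ∩ frontier s).Nonempty := by
  by_contra hne
  rw [not_nonempty_iff_eq_empty] at hne
  have hnf : ∀ x ∈ t, x ∉ frontier s := fun x hx hf => (hne.subset ⟨hx, hf⟩ : x ∈ (∅ : Set X))
  have hint : ∀ x ∈ t, x ∈ s → x ∈ interior s := fun x hx hs => by
    by_contra h
    exact hnf x hx ⟨subset_closure hs, h⟩
  have hext : ∀ x ∈ t, x ∉ s → x ∈ (closure s)ᶜ := fun x hx hs h =>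
    hnf x hx ⟨h, fun h' => hs (interior_subset h')⟩
  obtain ⟨x, hx, hxs⟩ := h1
  obtain ⟨y, hy, hys⟩ := h2
  obtain ⟨z, -, hz1, hz2⟩ := ht _ _ isOpen_interior isClosed_closure.isOpen_compl
    (fun z hz => (em (z ∈ s)).imp (hint z hz) (hext z hz)) ⟨x, hx, hint x hx hxs⟩
    ⟨y, hy, hext y hy hys⟩
  exact hz2 (subset_closure (interior_subset hz1))

/-- A segment joining `Ω` to its complement crosses the boundary, so the two distances to the
boundary add up to at most its length. -/
theorem infDist_add_infDist_le {x y : E N} (hx : x ∈ Ω) (hy : y ∉ Ω) :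
    infDist x (frontier Ω) + infDist y (frontier Ω) ≤ ‖x - y‖ := by
  obtain ⟨z, hz, hzf⟩ := inter_frontier_nonempty_of_isPreconnected
    (convex_segment (𝕜 := ℝ) x y).isPreconnected
    ⟨x, left_mem_segment ℝ x y, hx⟩ ⟨y, right_mem_segment ℝ x y, hy⟩
  have h1 := infDist_le_dist_of_mem (x := x) hzf
  have h2 := infDist_le_dist_of_mem (x := y) hzf
  have h3 := dist_add_dist_of_mem_segment hz
  rw [← dist_eq_norm]
  rw [dist_comm y z] at h2
  linarith

theorem abs_signedDist_sub_le (Ω : Set (E N)) (x y : E N) :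
    |signedDist Ω x - signedDist Ω y| ≤ ‖x - y‖ := by
  have h1 := infDist_le_infDist_add_dist (s := frontier Ω) (x := x) (y := y)
  have h2 := infDist_le_infDist_add_dist (s := frontier Ω) (x := y) (y := x)
  rw [dist_comm y x] at h2
  rw [dist_eq_norm] at h1 h2
  have h3 := infDist_nonneg (s := frontier Ω) (x := x)
  have h4 := infDist_nonneg (s := frontier Ω) (x := y)
  rw [signedDist, signedDist, abs_le]
  split_ifs with hx hy hy
  · constructor <;> linarith
  · have := infDist_add_infDist_le hx hy
    constructor <;> linarith
  · have := infDist_add_infDist_le hy hx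
    rw [norm_sub_rev] at this
    constructor <;> linarith
  · constructor <;> linarith

/-- If a unit vector `ν` is not the direction from `p` to `x`, then the ball about `x` through `p`
contains points close to `p` in directions making an obtuse angle with `ν`. -/
theorem exists_mem_ball_inner_lt {p x ν : E N} (hxp : x ≠ p) (hν : ‖ν‖ = 1)
    (hne : x - p ≠ ‖x - p‖ • ν) :
    ∃ ε > 0, ∀ ρ > 0, ∃ y ∈ ball p ρ, y ∈ ball x ‖x - p‖ ∧
      inner ℝ ν (y - p) < -(ε * ‖y - p‖) := by
  set d := ‖x - p‖ with hd
  have hd0 : 0 < d := norm_pos_iff.2 (sub_ne_zero.2 hxp)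
  set w := (x - p) - d • ν with hw
  have hw0 : 0 < ‖w‖ := norm_pos_iff.2 (sub_ne_zero.2 hne)
  have hsq : ‖w‖ ^ 2 = 2 * d ^ 2 - 2 * d * inner ℝ (x - p) ν := by
    rw [hw, norm_sub_sq_real, norm_smul, hν, inner_smul_right, Real.norm_of_nonneg hd0.le, ← hd]
    ring
  have h1 : inner ℝ (x - p) w = ‖w‖ ^ 2 / 2 := by
    rw [hsq, hw, inner_sub_right, real_inner_self_eq_norm_sq, inner_smul_right, ← hd]; ring
  have h2 : d * inner ℝ ν w = -(‖w‖ ^ 2 / 2) := by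
    rw [hsq, hw, inner_sub_right, inner_smul_right, real_inner_self_eq_norm_sq, hν,
      real_inner_comm]; ring
  refine ⟨‖w‖ / (4 * d), by positivity, fun ρ hρ => ?_⟩
  obtain ⟨s, hs0, hs⟩ := exists_between (show 0 < min (ρ / ‖w‖) 1 by positivity)
  have hs1 : s * ‖w‖ < ρ := (lt_div_iff₀ hw0).1 (hs.trans_le (min_le_left _ _))
  have hs2 : s < 1 := hs.trans_le (min_le_right _ _)
  have hyp : ‖p + s • w - p‖ = s * ‖w‖ := by
    rw [add_sub_cancel_left, norm_smul, Real.norm_of_nonneg hs0.le]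
  refine ⟨p + s • w, ?_, ?_, ?_⟩
  · rw [mem_ball, dist_eq_norm, hyp]; exact hs1
  · rw [mem_ball', dist_eq_norm]
    have h3 : ‖x - (p + s • w)‖ ^ 2 = d ^ 2 - s * (1 - s) * ‖w‖ ^ 2 := by
      rw [← sub_sub, norm_sub_sq_real, inner_smul_right, h1, norm_smul,
        Real.norm_of_nonneg hs0.le, ← hd]; ring
    refine lt_of_pow_lt_pow_left₀ 2 hd0.le ?_
    rw [h3]
    have : 0 < s * (1 - s) * ‖w‖ ^ 2 :=
      mul_pos (mul_pos hs0 (by linarith)) (by positivity)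
    linarith
  · rw [hyp, add_sub_cancel_left, inner_smul_right]
    have h3 : inner ℝ ν w = -(‖w‖ ^ 2 / (2 * d)) := by
      field_simp
      linarith
    rw [h3]
    have h4 : 0 < s * (‖w‖ ^ 2 / (4 * d)) := by positivity
    have h5 : s * -(‖w‖ ^ 2 / (2 * d)) = -(2 * (s * (‖w‖ ^ 2 / (4 * d)))) := by
      field_simp
      ring
    have h6 : -(‖w‖ / (4 * d) * (s * ‖w‖)) = -(s * (‖w‖ ^ 2 / (4 * d))) := by ring
    rw [h5, h6]
    linarith

/-- A nearest boundary point `p` of `x` satisfies `x = p + d(x) n(p)`: the ball about `x` through `p`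
does not meet the boundary, and so forces `x - p` to be normal. -/
theorem ChartSystem.exists_isProjection (c : ChartSystem Ω) (hcpt : IsCompact (frontier Ω))
    (hne : (frontier Ω).Nonempty) (x : E N) : ∃ p, IsProjection Ω x p := by
  obtain ⟨p, hp, hd⟩ := hcpt.exists_infDist_eq_dist hne x
  refine ⟨p, hp, ?_⟩
  rw [dist_eq_norm] at hd
  by_cases hxp : x = p
  · have h0 : signedDist Ω x = 0 := by
      rw [← abs_eq_zero, abs_signedDist, hd, hxp, sub_self, norm_zero]
    rw [h0, zero_smul, add_zero, hxp]
  have hn := c.isOuterUnitNormal_outerNormal hp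
  have hball : ∀ y ∈ ball x ‖x - p‖, (y ∈ Ω ↔ x ∈ Ω) := by
    intro y hy
    rw [mem_ball', dist_eq_norm, ← hd] at hy
    by_contra hiff
    rcases em (x ∈ Ω) with hx | hx
    · have := infDist_add_infDist_le hx (fun h => hiff (iff_of_true h hx))
      linarith [infDist_nonneg (s := frontier Ω) (x := y)]
    · have := infDist_add_infDist_le
        (not_not.1 fun h => hiff (iff_of_false h hx) : y ∈ Ω) hx
      rw [norm_sub_rev] at this
      linarith [infDist_nonneg (s := frontier Ω) (x := y)]
  by_cases hx : x ∈ Ω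
  · rw [signedDist, if_pos hx, hd]
    by_contra hcon
    obtain ⟨ε, hε, H⟩ := exists_mem_ball_inner_lt (ν := -outerNormal Ω p) hxp
      (by rw [norm_neg, hn.1]) (fun h => hcon (by rw [neg_smul, ← smul_neg, ← h]; abel))
    obtain ⟨ρ, hρ, Hρ⟩ := hn.2 ε hε
    obtain ⟨y, hy, hyx, hlt⟩ := H ρ hρ
    rw [inner_neg_left, neg_lt_neg_iff] at hlt
    exact (Hρ y hy).1 hlt (subset_closure ((hball y hyx).2 hx))
  · rw [signedDist, if_neg hx, hd]
    by_contra hcon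
    obtain ⟨ε, hε, H⟩ := exists_mem_ball_inner_lt (ν := outerNormal Ω p) hxp
      hn.1 (fun h => hcon (by rw [← h]; abel))
    obtain ⟨ρ, hρ, Hρ⟩ := hn.2 ε hε
    obtain ⟨y, hy, hyx, hlt⟩ := H ρ hρ
    exact hx ((hball y hyx).1 ((Hρ y hy).2 hlt))

/-- The normal coordinates `(p, s) ↦ p + s n(p)` determine the foot point `p` for small `s`. -/
theorem IsNormalBound.eq_of_add_smul_eq {L : ℝ} (hL : IsNormalBound Ω L) {p q : E N}
    (hp : p ∈ frontier Ω) (hq : q ∈ frontier Ω) (hnp : ‖outerNormal Ω p‖ = 1)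
    (hnq : ‖outerNormal Ω q‖ = 1) {s t : ℝ} (hs : |s| ≤ 1 / (8 * L)) (ht : |t| ≤ 1 / (8 * L))
    (h : p + s • outerNormal Ω p = q + t • outerNormal Ω q) : p = q := by
  have hL0 : 0 < L := zero_lt_one.trans_le hL.one_le
  have hδ : 1 / (8 * L) * L = 1 / 8 := by field_simp
  have hLip := hL.norm_sub_le p hp q hq
  have hQ := hL.abs_inner_le p hp q hq
  set n := outerNormal Ω p
  set m := outerNormal Ω q
  set δ := 1 / (8 * L)
  have hpq : p - q = t • (m - n) + (t - s) • n := by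
    rw [smul_sub, sub_smul]
    have : p = q + t • m - s • n := by rw [← h]; abel
    rw [this]; abel
  have hnm : ‖n - m‖ ^ 2 = 2 - 2 * inner ℝ n m := by
    rw [norm_sub_sq_real, hnp, hnq]; ring
  have hts : inner ℝ n (q - p) = -((t - s) - t * (‖n - m‖ ^ 2 / 2)) := by
    rw [← neg_sub p q, inner_neg_right, hpq, inner_add_right, inner_smul_right, inner_smul_right,
      inner_sub_right, real_inner_self_eq_norm_sq, hnp, hnm]; ring
  set r := ‖p - q‖ with hr
  have hr0 : 0 ≤ r := norm_nonneg _
  rw [norm_sub_rev, ← hr] at hQ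
  have htn : |t| * ‖n - m‖ ≤ 1 / 8 * r := by
    calc |t| * ‖n - m‖ ≤ δ * (L * r) := by gcongr
      _ = 1 / 8 * r := by rw [← mul_assoc, hδ]
  have h1 : r ≤ 1 / 8 * r + |t - s| := by
    calc r = ‖t • (m - n) + (t - s) • n‖ := by rw [← hpq]
      _ ≤ |t| * ‖n - m‖ + |t - s| := by
        refine (norm_add_le _ _).trans ?_
        rw [norm_smul, norm_smul, hnp, mul_one, Real.norm_eq_abs, Real.norm_eq_abs,
          norm_sub_rev m n]
      _ ≤ _ := by linarith
  have h2 : |t - s| ≤ L * r ^ 2 + 1 / 16 * r * (L * r) := by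
    have e : t - s = -inner ℝ n (q - p) + t * (‖n - m‖ ^ 2 / 2) := by linarith
    rw [e]
    refine (abs_add_le _ _).trans ?_
    rw [abs_neg, abs_mul, abs_of_nonneg (by positivity : 0 ≤ ‖n - m‖ ^ 2 / 2)]
    have : |t| * (‖n - m‖ ^ 2 / 2) = 1 / 2 * (|t| * ‖n - m‖) * ‖n - m‖ := by ring
    rw [this]
    have : 1 / 2 * (|t| * ‖n - m‖) * ‖n - m‖ ≤ 1 / 2 * (1 / 8 * r) * (L * r) := by gcongr
    linarith
  have h3 : L * r ≤ 1 / 4 := by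
    have : r ≤ |t| + |s| := by
      have e : p - q = t • m - s • n := by
        rw [sub_eq_sub_iff_add_eq_add, h]; abel
      rw [hr, e]
      refine (_root_.norm_sub_le _ _).trans ?_
      rw [norm_smul, norm_smul, hnp, hnq, mul_one, mul_one, Real.norm_eq_abs, Real.norm_eq_abs]
    have h4 : L * r ≤ L * (δ + δ) := by gcongr; linarith
    linarith
  have h5 : r ≤ 0 := by nlinarith
  exact sub_eq_zero.1 (norm_le_zero_iff.1 h5)

/-- Near the boundary, the foot point depends on the point in a Lipschitz continuous way. -/
theorem IsNormalBound.norm_sub_le_of_isProjection {L : ℝ} (hL : IsNormalBound Ω L)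
    {x y p q : E N} (hp : IsProjection Ω x p) (hq : IsProjection Ω y q)
    (hnp : ‖outerNormal Ω p‖ = 1) (hy : y ∈ tube Ω (1 / (8 * L))) : ‖p - q‖ ≤ 3 * ‖x - y‖ := by
  have hL0 : 0 < L := zero_lt_one.trans_le hL.one_le
  have hδ : 1 / (8 * L) * L = 1 / 8 := by field_simp
  have hLip := hL.norm_sub_le p hp.1 q hq.1
  have hd := abs_signedDist_sub_le Ω x y
  have hy' : |signedDist Ω y| ≤ 1 / (8 * L) := le_of_lt hy
  have e : p - q = (x - y) - (signedDist Ω x - signedDist Ω y) • outerNormal Ω p -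
      signedDist Ω y • (outerNormal Ω p - outerNormal Ω q) := by
    rw [smul_sub, sub_smul]
    nth_rewrite 1 [hp.2, hq.2]
    abel
  have h1 : ‖p - q‖ ≤ ‖x - y‖ + |signedDist Ω x - signedDist Ω y| +
      |signedDist Ω y| * ‖outerNormal Ω p - outerNormal Ω q‖ := by
    nth_rewrite 1 [e]
    refine (_root_.norm_sub_le _ _).trans ?_
    rw [norm_smul (signedDist Ω y), Real.norm_eq_abs]
    gcongr
    refine (_root_.norm_sub_le _ _).trans ?_
    rw [norm_smul, hnp, mul_one, Real.norm_eq_abs]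
  have h2 : |signedDist Ω y| * ‖outerNormal Ω p - outerNormal Ω q‖ ≤ 1 / 8 * ‖p - q‖ := by
    calc _ ≤ 1 / (8 * L) * (L * ‖p - q‖) := by gcongr
      _ = _ := by rw [← mul_assoc, hδ]
  linarith [norm_nonneg (x - y)]

theorem isProjection_proj {x : E N} (h : ∃ p, IsProjection Ω x p) :
    IsProjection Ω x (proj Ω x) := by
  rw [proj, dif_pos h]
  exact h.choose_spec

variable {h : ℝ}

/-! ### The polyhedral boundary -/

theorem Mesh.finite_boundaryMesh (𝒯 : Mesh N h) : 𝒯.boundaryMesh.Finite := by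
  classical
  refine ((𝒯.cells.biUnion Finset.powerset).finite_toSet).subset fun S hS => ?_
  obtain ⟨-, ⟨T, hT, hST⟩, -⟩ := hS
  exact Finset.mem_coe.2 (Finset.mem_biUnion.2 ⟨T, hT, Finset.mem_powerset.2 hST⟩)

theorem isCompact_convexHull_finset (S : Finset (E N)) :
    IsCompact (convexHull ℝ (S : Set (E N))) := S.finite_toSet.isCompact_convexHull ℝ

theorem Mesh.isCompact_boundary (𝒯 : Mesh N h) : IsCompact 𝒯.boundary :=
  𝒯.finite_boundaryMesh.isCompact_biUnion fun S _ => isCompact_convexHull_finset S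

theorem Mesh.mem_boundary (𝒯 : Mesh N h) {x : E N} :
    x ∈ 𝒯.boundary ↔ ∃ S ∈ 𝒯.boundaryMesh, x ∈ convexHull ℝ (S : Set (E N)) := by
  simp [Mesh.boundary]

theorem Mesh.norm_sub_le (𝒯 : Mesh N h) {S : Finset (E N)} (hS : S ∈ 𝒯.boundaryMesh) {x y : E N}
    (hx : x ∈ convexHull ℝ (S : Set (E N))) (hy : y ∈ convexHull ℝ (S : Set (E N))) :
    ‖x - y‖ ≤ h := by
  obtain ⟨-, ⟨T, hT, hST⟩, -⟩ := hS
  have hsub := convexHull_mono (𝕜 := ℝ) (Finset.coe_subset.2 hST)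
  rw [← dist_eq_norm]
  exact (dist_le_diam_of_mem (isCompact_convexHull_finset T).isBounded (hsub hx)
    (hsub hy)).trans (𝒯.diam_le T hT)

theorem exists_mem_of_mem_convexHull {S : Finset (E N)} {x : E N}
    (hx : x ∈ convexHull ℝ (S : Set (E N))) : ∃ v, v ∈ S := by
  have : (convexHull ℝ (S : Set (E N))).Nonempty := ⟨x, hx⟩
  rw [convexHull_nonempty_iff] at this
  exact this

/-- The interpolation error estimate on one face whose vertices lie in the chart: up to an error
`K h²` its vertices satisfy an affine equation, hence so do all of its points. -/
theorem ChartSystem.IsBound.abs_sub_le_of_mem_face {c : ChartSystem Ω} {K : ℝ}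
    (hK : c.IsBound K) (r : Fin c.M) {𝒯 : Mesh N h} {S : Finset (E N)} (hS : S ∈ 𝒯.boundaryMesh)
    (hSU : ∀ v ∈ S, v ∈ c.U r) (hSΓ : (S : Set (E N)) ⊆ frontier Ω) {x : E N}
    (hx : x ∈ convexHull ℝ (S : Set (E N)))
    (hxα : (c.A r x).fst ∈ ball (0 : E (N - 1)) c.α) :
    |(c.A r x).snd - c.φ r (c.A r x).fst| ≤ K * h ^ 2 := by
  have hK0 : 0 ≤ K := zero_le_one.trans hK.one_le
  set a := (c.A r x).fst with ha
  set D := fderiv ℝ (c.φ r) a with hD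
  have hconv : Convex ℝ {z : E N | |(c.A r z).snd - c.φ r a - D ((c.A r z).fst - a)| ≤
      K * h ^ 2} := by
    intro z hz w hw s t hs ht hst
    simp only [mem_ofPred_eq] at hz hw ⊢
    have haff : c.A r (s • z + t • w) = s • c.A r z + t • c.A r w :=
      Convex.combo_affine_apply (f := (c.A r).toAffineEquiv.toAffineMap) hst
    have e : (c.A r (s • z + t • w)).snd - c.φ r a - D ((c.A r (s • z + t • w)).fst - a) =
        s * ((c.A r z).snd - c.φ r a - D ((c.A r z).fst - a)) +
        t * ((c.A r w).snd - c.φ r a - D ((c.A r w).fst - a)) := by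
      rw [haff]
      simp only [WithLp.add_snd, WithLp.smul_snd, WithLp.add_fst, WithLp.smul_fst, map_sub,
        map_add, map_smul, smul_eq_mul]
      linear_combination (c.φ r a - D a) * hst
    rw [e]
    refine (abs_add_le _ _).trans ?_
    rw [abs_mul, abs_mul, abs_of_nonneg hs, abs_of_nonneg ht]
    calc _ ≤ s * (K * h ^ 2) + t * (K * h ^ 2) := by gcongr
      _ = K * h ^ 2 := by rw [← add_mul, hst, one_mul]
  have hmem := convexHull_min (𝕜 := ℝ) (s := (S : Set (E N))) (fun v hv => ?_) hconv hx
  · simpa [← ha] using hmem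
  · have hvU := hSU v hv
    have h1 := hK.taylor r hxα hvU.1
    rw [mem_ofPred_eq, (c.mem_frontier_iff r hvU).1 (hSΓ hv)]
    refine h1.trans ?_
    gcongr
    exact (norm_fst_chart_sub_le (c.A r) v x).trans
      (𝒯.norm_sub_le hS (subset_convexHull ℝ _ hv) hx)

/-- Each point of the polyhedral boundary lies, together with the vertices of its face, in a chart,
and so is at distance `O(h²)` from the boundary. -/
theorem ChartSystem.IsBound.exists_norm_sub_le {c : ChartSystem Ω} {K h₀ : ℝ} (hK : c.IsBound K)
    (hh₀ : c.IsCoverRadius h₀) {𝒯 : Mesh N h} (h𝒯 : 𝒯.IsCompatible c h₀) {x : E N}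
    (hx : x ∈ 𝒯.boundary) : ∃ p ∈ frontier Ω, ‖x - p‖ ≤ K * h ^ 2 := by
  obtain ⟨S, hS, hxS⟩ := 𝒯.mem_boundary.1 hx
  obtain ⟨v, hv⟩ := exists_mem_of_mem_convexHull hxS
  have hSΓ := h𝒯.2.2.2 S hS
  have hh : h < h₀ := h𝒯.2.1.trans_le (min_le_left _ _)
  obtain ⟨r, hr⟩ := hh₀.2 v (hSΓ hv)
  have hU : convexHull ℝ (S : Set (E N)) ⊆ c.U r := fun y hy => hr <| by
    rw [mem_ball, dist_eq_norm]
    exact (𝒯.norm_sub_le hS hy (subset_convexHull ℝ _ hv)).trans_lt hh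
  have hxU := hU hxS
  refine ⟨_, c.chartPoint_mem_frontier r hxU.1, (norm_sub_le_chart (c.A r) _ _).trans ?_⟩
  rw [fst_chartPoint, snd_chartPoint, sub_self, norm_zero, zero_add]
  exact hK.abs_sub_le_of_mem_face r hS (fun w hw => hU (subset_convexHull ℝ _ hw)) hSΓ hxS hxU.1

theorem Mesh.IsGraphOver.chartPoint_mem {c : ChartSystem Ω} {r : Fin c.M} {𝒯 : Mesh N h}
    {ψ : E (N - 1) → ℝ} (hψ : 𝒯.IsGraphOver c r ψ) {y : E (N - 1)}
    (hy : y ∈ ball (0 : E (N - 1)) c.α) :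
    chartPoint (c.A r) y (ψ y) ∈ 𝒯.boundary ∩ c.U r :=
  hψ.2.superset ⟨by simpa using hy, by simp⟩

theorem Mesh.IsGraphOver.snd_eq {c : ChartSystem Ω} {r : Fin c.M} {𝒯 : Mesh N h}
    {ψ : E (N - 1) → ℝ} (hψ : 𝒯.IsGraphOver c r ψ) {x : E N} (hx : x ∈ 𝒯.boundary)
    (hxU : x ∈ c.U r) : (c.A r x).snd = ψ (c.A r x).fst := (hψ.2.subset ⟨hx, hxU⟩).2

/-- A face lying over `Δ_r` which meets `U_r` is contained in `U_r`: in the (connected) face, its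
intersection with `U_r` is open, and it is closed because it is the intersection with the graph of
the continuous function `ψ`. -/
theorem Mesh.IsGraphOver.face_subset_U {c : ChartSystem Ω} {r : Fin c.M} {𝒯 : Mesh N h}
    {ψ : E (N - 1) → ℝ} (hψ : 𝒯.IsGraphOver c r ψ) {S : Finset (E N)} (hS : S ∈ 𝒯.boundaryMesh)
    (hα : ∀ z ∈ convexHull ℝ (S : Set (E N)), (c.A r z).fst ∈ ball (0 : E (N - 1)) c.α) {x : E N}
    (hx : x ∈ convexHull ℝ (S : Set (E N))) (hxU : x ∈ c.U r) :
    convexHull ℝ (S : Set (E N)) ⊆ c.U r := by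
  have hΔ : IsOpen {z : E N | (c.A r z).fst ∈ ball (0 : E (N - 1)) c.α} :=
    isOpen_ball.preimage (continuous_fst_chart _)
  have hcont : ContinuousOn (fun z => (c.A r z).snd - ψ (c.A r z).fst)
      {z : E N | (c.A r z).fst ∈ ball (0 : E (N - 1)) c.α} :=
    (continuous_snd_chart _).continuousOn.sub
      (hψ.1.comp (continuous_fst_chart _).continuousOn fun z hz => hz)
  have hopen := hcont.isOpen_inter_preimage hΔ (isOpen_compl_singleton (x := (0 : ℝ)))
  have key : ∀ z ∈ convexHull ℝ (S : Set (E N)),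
      (z ∈ c.U r ↔ (c.A r z).snd - ψ (c.A r z).fst = 0) := fun z hz =>
    ⟨fun hzU => sub_eq_zero.2 (hψ.snd_eq (𝒯.mem_boundary.2 ⟨S, hS, hz⟩) hzU),
      fun h0 => (hψ.2.superset ⟨hα z hz, sub_eq_zero.1 h0⟩).2⟩
  have hpre := isPreconnected_iff_subset_of_disjoint.1
    (convex_convexHull ℝ (S : Set (E N))).isPreconnected _ _ (c.isOpen_U r) hopen
    (fun z hz => (em (z ∈ c.U r)).imp id fun hzU => ⟨hα z hz, fun h0 => hzU ((key z hz).2 h0)⟩)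
    (eq_empty_of_forall_notMem fun z hz => hz.2.2.2 ((key z hz.1).1 hz.2.1))
  exact hpre.resolve_right fun h' => (h' hx).2 ((key x hx).1 hxU)

/-- The graph functions of boundary and polyhedral boundary nowhere differ by an amount between
`O(h²)` and a fixed `ρ > 0`: a boundary point near the polyhedral boundary lies on the sheet of the
boundary given by `c.φ r`, and this sheet is transversal to the vertical direction. -/
theorem ChartSystem.IsBound.abs_sub_le_of_lt {c : ChartSystem Ω} {K L h₀ : ℝ} (hK : c.IsBound K)
    (hL : IsNormalBound Ω L) (hh₀ : c.IsCoverRadius h₀) {𝒯 : Mesh N h}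
    (h𝒯 : 𝒯.IsCompatible c h₀) {r : Fin c.M} {ψ : E (N - 1) → ℝ} (hψ : 𝒯.IsGraphOver c r ψ)
    {y : E (N - 1)} (hy : y ∈ ball (0 : E (N - 1)) c.α)
    (hh : K * h ^ 2 ≤ 1 / (4 * (1 + K) * L)) (hlt : |c.φ r y - ψ y| < 1 / (4 * (1 + K) * L)) :
    |c.φ r y - ψ y| ≤ (2 * K + 4) * (K * h ^ 2) := by
  have hK0 : 0 < K := zero_lt_one.trans_le hK.one_le
  have hL0 : 0 < L := zero_lt_one.trans_le hL.one_le
  obtain ⟨p, hp, hxp⟩ := hK.exists_norm_sub_le hh₀ h𝒯 (hψ.chartPoint_mem hy).1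
  set x := chartPoint (c.A r) y (ψ y) with hx
  set q := chartPoint (c.A r) y (c.φ r y) with hq
  set η := K * h ^ 2
  set ρ := 1 / (4 * (1 + K) * L) with hρ
  have hρ' : (1 + K) * (L * (2 * ρ)) = 1 / 2 := by rw [hρ]; field_simp; norm_num
  have hxq := norm_sub_le_chart (c.A r) x q
  have hfst := norm_fst_chart_sub_le (c.A r) x p
  have hsnd := abs_snd_chart_sub_le (c.A r) x p
  have htr := hK.abs_snd_le r (c.chartPoint_mem_frontier r hy) (c.chartPoint_mem_U r hy) p q
  have hin := hL.abs_inner_le q (c.chartPoint_mem_frontier r hy) p hp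
  have hpq := norm_sub_le_chart (c.A r) p q
  rw [← hq] at htr
  simp only [hx, hq, fst_chartPoint, snd_chartPoint, sub_self, norm_zero, zero_add]
    at hxq hfst hsnd htr hpq
  simp only [← hx, ← hq] at hxq hfst hsnd htr hpq
  rw [norm_sub_rev] at hfst
  have h1 : ‖p - q‖ ≤ 2 * ρ := by
    have := norm_sub_le_norm_sub_add_norm_sub p x q
    rw [norm_sub_rev p x] at this
    rw [abs_sub_comm] at hxq
    linarith
  set a := ‖(c.A r p).fst - y‖
  set b := |(c.A r p).snd - c.φ r y|
  have hb0 : 0 ≤ b := abs_nonneg _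
  have ha0 : 0 ≤ a := norm_nonneg _
  have h2 : |inner ℝ (outerNormal Ω q) (p - q)| ≤ L * (2 * ρ) * (a + b) := by
    calc _ ≤ L * ‖p - q‖ ^ 2 := hin
      _ = L * ‖p - q‖ * ‖p - q‖ := by ring
      _ ≤ _ := by gcongr
  have h3 : b ≤ (1 + K) * a + 1 / 2 * (a + b) := by
    calc b ≤ (1 + K) * (a + L * (2 * ρ) * (a + b)) := htr.trans (by gcongr)
      _ = (1 + K) * a + (1 + K) * (L * (2 * ρ)) * (a + b) := by ring
      _ = _ := by rw [hρ']
  have h4 : a ≤ η := hfst.trans hxp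
  have h5 : b ≤ (2 * K + 3) * η := by
    have : (2 * K + 3) * a ≤ (2 * K + 3) * η := by gcongr
    linarith
  have h6 : |ψ y - (c.A r p).snd| ≤ η := hsnd.trans hxp
  have h7 := _root_.abs_sub_le (ψ y) (c.A r p).snd (c.φ r y)
  rw [abs_sub_comm]
  linarith

/-- The interpolation error estimate. Over the centre of the chart, the face of the polyhedral
boundary is contained in the chart, and the error is `O(h²)`; as errors between `O(h²)` and a fixed
`ρ` are excluded, continuity propagates the estimate to the whole chart. For `h` bounded below, the
height of the chart is a trivial bound. -/
theorem ChartSystem.exists_isInterpolationConstant (c : ChartSystem Ω) {h₀ : ℝ}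
    (hh₀ : c.IsCoverRadius h₀) : ∃ C : ℝ, ∀ σ : ℝ, IsInterpolationConstant c h₀ σ C := by
  obtain ⟨K, hK⟩ := c.exists_isBound
  obtain ⟨L, hL⟩ := c.exists_isNormalBound hh₀
  have hK0 : 0 < K := zero_lt_one.trans_le hK.one_le
  have hL0 : 0 < L := zero_lt_one.trans_le hL.one_le
  have hα := c.α_pos
  have hβ := c.β_pos
  set ρ := 1 / (4 * (1 + K) * L) with hρ
  have hρ0 : 0 < ρ := by positivity
  set C₁ := (2 * K + 4) * K with hC₁
  have hC₁0 : 0 < C₁ := by positivity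
  set h' := min c.α (ρ / C₁) with hh'
  have hh'0 : 0 < h' := by positivity
  refine ⟨C₁ + c.β / h' ^ 2, fun σ => ⟨by positivity, fun h 𝒯 h𝒯 _ r ψ hψ y hy => ?_⟩⟩
  have hh0 : 0 < h := h𝒯.1
  have hh1 : h < 1 := h𝒯.2.1.trans_le (min_le_right _ _)
  rcases lt_or_ge h h' with hlt | hge
  · have hlt1 : h < c.α := hlt.trans_le (min_le_left _ _)
    have hlt2 : C₁ * h ^ 2 < ρ := by
      have h1 : h < ρ / C₁ := hlt.trans_le (min_le_right _ _)
      rw [lt_div_iff₀ hC₁0] at h1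
      have h2 : h ^ 2 ≤ h := by nlinarith
      have h3 : C₁ * h ^ 2 ≤ C₁ * h := by gcongr
      linarith
    have hsmall : K * h ^ 2 ≤ C₁ * h ^ 2 := by
      gcongr
      nlinarith
    have hgap : ∀ z ∈ ball (0 : E (N - 1)) c.α, |c.φ r z - ψ z| < ρ →
        |c.φ r z - ψ z| ≤ C₁ * h ^ 2 := fun z hz hzρ => by
      rw [hC₁, mul_assoc]
      exact hK.abs_sub_le_of_lt hL hh₀ h𝒯 hψ hz (hsmall.trans hlt2.le) hzρ
    have h0 : (0 : E (N - 1)) ∈ ball (0 : E (N - 1)) c.α := mem_ball_self hα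
    have hcentre : |c.φ r 0 - ψ 0| < ρ := by
      obtain ⟨hx, hxU⟩ := hψ.chartPoint_mem h0
      set x := chartPoint (c.A r) 0 (ψ 0) with hxdef
      obtain ⟨S, hS, hxS⟩ := 𝒯.mem_boundary.1 hx
      have hSα : ∀ z ∈ convexHull ℝ (S : Set (E N)),
          (c.A r z).fst ∈ ball (0 : E (N - 1)) c.α := fun z hz => by
        have h1 := norm_fst_chart_sub_le (c.A r) z x
        rw [hxdef, fst_chartPoint, sub_zero, ← hxdef] at h1
        exact mem_ball_zero_iff.2 ((h1.trans (𝒯.norm_sub_le hS hz hxS)).trans_lt hlt1)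
      have hSU := hψ.face_subset_U hS hSα hxS hxU
      have h2 := hK.abs_sub_le_of_mem_face r hS (fun v hv => hSU (subset_convexHull ℝ _ hv))
        (h𝒯.2.2.2 S hS) hxS hxU.1
      rw [hxdef, fst_chartPoint, snd_chartPoint, abs_sub_comm] at h2
      linarith
    have hcont : ContinuousOn (fun z => |c.φ r z - ψ z|) (ball (0 : E (N - 1)) c.α) :=
      ((c.continuousOn r).sub hψ.1).abs
    have hu := hcont.isOpen_inter_preimage isOpen_ball (isOpen_Iio (a := ρ))
    have hv := hcont.isOpen_inter_preimage isOpen_ball (isOpen_Ioi (a := C₁ * h ^ 2))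
    have hsub := isPreconnected_iff_subset_of_disjoint.1
      (convex_ball (0 : E (N - 1)) c.α).isPreconnected _ _ hu hv
      (fun z hz => (lt_or_ge |c.φ r z - ψ z| ρ).imp (fun h1 => ⟨hz, h1⟩)
        fun h1 => ⟨hz, hlt2.trans_le h1⟩)
      (eq_empty_of_forall_notMem fun z hz => (hgap z hz.1 hz.2.1.2).not_gt hz.2.2.2)
    have hsub' := hsub.resolve_right fun hsub' =>
      (hgap 0 h0 hcentre).not_gt (hsub' h0).2
    have h1 := hgap y hy (hsub' hy).2
    have h2 : 0 ≤ c.β / h' ^ 2 * h ^ 2 := by positivity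
    rw [add_mul]
    linarith
  · obtain ⟨-, hU⟩ := hψ.chartPoint_mem hy
    have h1 := hU.2
    rw [fst_chartPoint, snd_chartPoint] at h1
    have h2 : c.β ≤ c.β / h' ^ 2 * h ^ 2 := by
      calc c.β = c.β / h' ^ 2 * h' ^ 2 := by field_simp
        _ ≤ _ := by gcongr
    have h3 : 0 ≤ C₁ * h ^ 2 := by positivity
    rw [add_mul, abs_le]
    constructor <;> linarith [h1.1, h1.2]

/-! ### Slopes of the polyhedral boundary -/

/-- A continuous function that is `L`-Lipschitz on each of finitely many closed sets covering `[0, 1]`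
increases by at most `L` over it: at each point, one of the sets contains points to the right
arbitrarily close by. -/
theorem sub_le_of_finite_closed_cover {ι : Type*} {I : Set ι} (hI : I.Finite) {F : ι → Set ℝ}
    {f : ℝ → ℝ} {L : ℝ} (hf : ContinuousOn f (Icc 0 1)) (hF : ∀ i ∈ I, IsClosed (F i))
    (hcov : ∀ t ∈ Icc (0 : ℝ) 1, ∃ i ∈ I, t ∈ F i)
    (hL : ∀ i ∈ I, ∀ s ∈ Icc (0 : ℝ) 1, ∀ t ∈ Icc (0 : ℝ) 1, s ∈ F i → t ∈ F i →
      |f s - f t| ≤ L * |s - t|) : f 1 - f 0 ≤ L := by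
  have key := image_le_of_liminf_slope_right_le_deriv_boundary (B := fun t => f 0 + L * t)
    (B' := fun _ => L) hf (by simp) (by fun_prop)
    (fun x _ => by simpa using (((hasDerivAt_id x).const_mul L).const_add (f 0)).hasDerivWithinAt)
    (fun x hx r hr => ?_)
  · have := key (right_mem_Icc.2 zero_le_one)
    linarith
  have hev : ∀ᶠ z in 𝓝[>] x, z ∈ Ioc x 1 := Ioc_mem_nhdsGT hx.2
  obtain ⟨i, hi, hfreq⟩ : ∃ i ∈ I, ∃ᶠ z in 𝓝[>] x, z ∈ F i := by
    by_contra! hcon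
    have hall : ∀ᶠ z in 𝓝[>] x, ∀ i ∈ I, z ∉ F i :=
      (eventually_all_finite hI).2 fun i hi => hcon i hi
    obtain ⟨z, hz, hz'⟩ := (hall.and hev).exists
    obtain ⟨i, hi, hzi⟩ := hcov z ⟨hx.1.trans hz'.1.le, hz'.2⟩
    exact hz i hi hzi
  have hxF : x ∈ F i := (hF i hi).closure_eq ▸
    mem_closure_iff_frequently.2 (hfreq.filter_mono nhdsWithin_le_nhds)
  refine (hfreq.and_eventually hev).mono fun z hz => ?_
  have hpos : 0 < z - x := sub_pos.2 hz.2.1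
  have h1 := hL i hi z ⟨hx.1.trans hz.2.1.le, hz.2.2⟩ x ⟨hx.1, hx.2.le⟩ hz.1 hxF
  rw [abs_of_pos hpos] at h1
  rw [slope_def_field, div_lt_iff₀ hpos]
  have h2 := le_abs_self (f z - f x)
  have h3 : L * (z - x) < r * (z - x) := by gcongr
  linarith

/-- An affine function with values in `[0, 1]` on `K` varies by at most `1` along a diameter of a
ball inscribed in `K`, which bounds its gradient. -/
theorem abs_linear_mul_inscribedDiam_le {K : Set (E N)} (hK : K.Nonempty) (f : E N →ᵃ[ℝ] ℝ)
    (hf : ∀ x ∈ K, f x ∈ Icc (0 : ℝ) 1) (u : E N) : |f.linear u| * inscribedDiam K ≤ ‖u‖ := by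
  rcases eq_or_ne (f.linear u) 0 with h0 | h0
  · rw [h0, abs_zero, zero_mul]; exact norm_nonneg _
  have hu : 0 < ‖u‖ := norm_pos_iff.2 fun h => h0 (by rw [h, map_zero])
  have hpos : 0 < |f.linear u| := abs_pos.2 h0
  rw [mul_comm, ← le_div_iff₀ hpos]
  refine csSup_le ?_ ?_
  · obtain ⟨x, hx⟩ := hK
    exact ⟨2 * 0, x, 0, le_rfl, by simpa using hx, rfl⟩
  · rintro s ⟨c, r, hr, hball, rfl⟩
    rw [le_div_iff₀ hpos]
    set v := (r / ‖u‖) • u with hv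
    have hvn : ‖v‖ = r := by
      rw [hv, norm_smul, Real.norm_of_nonneg (by positivity), div_mul_cancel₀ _ hu.ne']
    have h1 := hf _ (hball (show v +ᵥ c ∈ closedBall c r by simp [hvn]))
    have h2 := hf _ (hball (show (-v) +ᵥ c ∈ closedBall c r by simp [hvn]))
    rw [f.map_vadd, vadd_eq_add] at h1 h2
    rw [map_neg] at h2
    have h3 : |2 * f.linear v| ≤ 1 := by
      rw [abs_le]; constructor <;> linarith [h1.1, h1.2, h2.1, h2.2]
    rw [hv, map_smul, smul_eq_mul, abs_mul, abs_mul, abs_of_nonneg (by positivity : 0 ≤ r / ‖u‖),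
      abs_two] at h3
    calc 2 * r * |f.linear u| = 2 * (r / ‖u‖ * |f.linear u|) * ‖u‖ := by field_simp
      _ ≤ 1 * ‖u‖ := by gcongr
      _ = ‖u‖ := one_mul _

/-- In a shape regular mesh, a linear form that is small on the edges of a face is small on all
differences of points of the face, relative to their length: the barycentric coordinates of the cell
have gradients bounded by `1 / ρ_T`. -/
theorem Mesh.IsRegular.abs_le_of_edges {𝒯 : Mesh N h} {σ : ℝ} (hσ : 𝒯.IsRegular σ)
    {S T : Finset (E N)} (hT : T ∈ 𝒯.cells) (hST : S ⊆ T) (l : E N →ₗ[ℝ] ℝ) {M : ℝ} (hM : 0 ≤ M)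
    (hl : ∀ v ∈ S, ∀ w ∈ S, |l (v - w)| ≤ M * diam (convexHull ℝ (T : Set (E N)))) {x y : E N}
    (hx : x ∈ convexHull ℝ (S : Set (E N))) (hy : y ∈ convexHull ℝ (S : Set (E N))) :
    |l (x - y)| ≤ (N + 1) * (M * |σ|) * ‖x - y‖ := by
  classical
  have hcard : Fintype.card T = Module.finrank ℝ (E N) + 1 := by
    rw [Fintype.card_coe, 𝒯.card_eq T hT, finrank_euclideanSpace_fin]
  have hind := 𝒯.affineIndependent T hT
  let b : AffineBasis T ℝ (E N) :=
    ⟨((↑) : T → E N), hind, hind.affineSpan_eq_top_iff_card_eq_finrank_add_one.2 hcard⟩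
  have hb : ∀ i : T, b i = (i : E N) := fun i => rfl
  obtain ⟨v₀, hv₀⟩ := exists_mem_of_mem_convexHull hx
  have hvert : ∀ (i : T) (v : E N), v ∈ T → b.coord i v = if (i : E N) = v then 1 else 0 := by
    intro i v hv
    have := b.coord_apply i ⟨v, hv⟩
    rw [hb] at this
    rw [this]
    exact if_congr Subtype.ext_iff rfl rfl
  have hunit : ∀ i : T, ∀ z ∈ convexHull ℝ (T : Set (E N)), b.coord i z ∈ Icc (0 : ℝ) 1 :=
    fun i => convexHull_min (t := b.coord i ⁻¹' Icc 0 1) (fun v hv => by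
      rw [mem_preimage, hvert i v hv]; split_ifs <;> simp)
      ((convex_Icc (0 : ℝ) 1).affine_preimage (b.coord i))
  have hzero : ∀ i : T, (i : E N) ∉ S → ∀ z ∈ convexHull ℝ (S : Set (E N)), b.coord i z = 0 :=
    fun i hi => convexHull_min (t := b.coord i ⁻¹' {0}) (fun v hv => by
      rw [mem_preimage, hvert i v (hST hv), if_neg fun h : (i : E N) = v => hi (h ▸ hv)]; rfl)
      ((convex_singleton (0 : ℝ)).affine_preimage (b.coord i))
  have hcoef : ∀ i : T, |b.coord i x - b.coord i y| * diam (convexHull ℝ (T : Set (E N))) ≤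
      |σ| * ‖x - y‖ := by
    intro i
    have h1 := abs_linear_mul_inscribedDiam_le (K := convexHull ℝ (T : Set (E N)))
      ⟨v₀, subset_convexHull ℝ _ (hST hv₀)⟩ (b.coord i) (hunit i) (x - y)
    have h2 : (b.coord i).linear (x - y) = b.coord i x - b.coord i y :=
      (b.coord i).linearMap_vsub x y
    rw [h2] at h1
    have h3 : 0 ≤ inscribedDiam (convexHull ℝ (T : Set (E N))) := by
      refine Real.sSup_nonneg ?_
      rintro s ⟨c, r, hr, -, rfl⟩
      positivity
    calc _ ≤ |b.coord i x - b.coord i y| *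
          (|σ| * inscribedDiam (convexHull ℝ (T : Set (E N)))) := by
            gcongr
            exact (hσ T hT).trans (mul_le_mul_of_nonneg_right (le_abs_self σ) h3)
      _ = |σ| * (|b.coord i x - b.coord i y| *
          inscribedDiam (convexHull ℝ (T : Set (E N)))) := by ring
      _ ≤ _ := by gcongr
  have hsum : l (x - y) = ∑ i : T, (b.coord i x - b.coord i y) * l ((i : E N) - v₀) := by
    have e : x - y = ∑ i : T, (b.coord i x - b.coord i y) • ((i : E N) - v₀) := by
      simp only [smul_sub, sub_smul, Finset.sum_sub_distrib, ← Finset.sum_smul,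
        b.sum_coord_apply_eq_one]
      have hx' := b.linear_combination_coord_eq_self x
      have hy' := b.linear_combination_coord_eq_self y
      simp only [hb] at hx' hy'
      rw [hx', hy']
      abel
    rw [e, map_sum]
    simp only [map_smul, smul_eq_mul]
  rw [hsum]
  refine (Finset.abs_sum_le_sum_abs _ _).trans ?_
  have hterm : ∀ i ∈ (Finset.univ : Finset T),
      |(b.coord i x - b.coord i y) * l ((i : E N) - v₀)| ≤ M * |σ| * ‖x - y‖ := by
    intro i _
    by_cases hi : (i : E N) ∈ S
    · rw [abs_mul]
      calc _ ≤ |b.coord i x - b.coord i y| * (M * diam (convexHull ℝ (T : Set (E N)))) := by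
            gcongr; exact hl _ hi _ hv₀
        _ = M * (|b.coord i x - b.coord i y| * diam (convexHull ℝ (T : Set (E N)))) := by ring
        _ ≤ M * (|σ| * ‖x - y‖) := mul_le_mul_of_nonneg_left (hcoef i) hM
        _ = _ := by ring
    · rw [hzero i hi x hx, hzero i hi y hy, sub_zero, zero_mul, abs_zero]
      positivity
  refine (Finset.sum_le_sum hterm).trans (le_of_eq ?_)
  rw [Finset.sum_const, Finset.card_univ, Fintype.card_coe, 𝒯.card_eq T hT, nsmul_eq_mul]
  push_cast
  ring

/-- A face close to the boundary point `p` is nearly tangential at `p`. -/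
theorem IsNormalBound.abs_inner_le_of_mem_face {L : ℝ} (hL : IsNormalBound Ω L) {𝒯 : Mesh N h}
    {σ : ℝ} (hσ : 𝒯.IsRegular σ) {S : Finset (E N)} (hS : S ∈ 𝒯.boundaryMesh)
    (hSΓ : (S : Set (E N)) ⊆ frontier Ω) (hh : 0 ≤ h) {p : E N} (hp : p ∈ frontier Ω) {M : ℝ}
    (hM : 0 ≤ M) {x y : E N} (hx : x ∈ convexHull ℝ (S : Set (E N)))
    (hy : y ∈ convexHull ℝ (S : Set (E N))) (hxp : ‖p - x‖ ≤ M * h) :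
    |inner ℝ (outerNormal Ω p) (x - y)| ≤ (N + 1) * (L * (M + 2) * h * |σ|) * ‖x - y‖ := by
  have hL0 : 0 < L := zero_lt_one.trans_le hL.one_le
  obtain ⟨T, hT, hST⟩ := hS.2.1
  refine hσ.abs_le_of_edges hT hST (innerₛₗ ℝ (outerNormal Ω p)) (by positivity)
    (fun v hv w hw => ?_) hx hy
  have hvS := subset_convexHull ℝ (S : Set (E N)) hv
  have hsub := subset_convexHull ℝ (T : Set (E N))
  have hd : ‖w - v‖ ≤ diam (convexHull ℝ (T : Set (E N))) := by
    rw [← dist_eq_norm]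
    exact dist_le_diam_of_mem (isCompact_convexHull_finset T).isBounded (hsub (hST hw))
      (hsub (hST hv))
  have hpv : ‖p - v‖ ≤ (M + 1) * h := by
    have h1 := norm_sub_le_norm_sub_add_norm_sub p x v
    have h2 := 𝒯.norm_sub_le hS hx hvS
    linarith
  have h1 := hL.abs_inner_le v (hSΓ hv) w (hSΓ hw)
  have h2 := hL.norm_sub_le p hp v (hSΓ hv)
  have h3 : inner ℝ (outerNormal Ω p) (v - w) = -(inner ℝ (outerNormal Ω v) (w - v) +
      inner ℝ (outerNormal Ω p - outerNormal Ω v) (w - v)) := by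
    rw [inner_sub_left, ← neg_sub w v, inner_neg_right]; ring
  rw [innerₛₗ_apply_apply, h3, abs_neg]
  refine (abs_add_le _ _).trans ?_
  calc _ ≤ L * ‖w - v‖ ^ 2 + (L * ((M + 1) * h)) * ‖w - v‖ := by
        refine add_le_add h1 ((abs_real_inner_le_norm _ _).trans ?_)
        gcongr
        exact h2.trans (by gcongr)
    _ = L * (‖w - v‖ + (M + 1) * h) * ‖w - v‖ := by ring
    _ ≤ L * (h + (M + 1) * h) * diam (convexHull ℝ (T : Set (E N))) := by
        gcongr
        exact hd.trans (𝒯.diam_le T hT)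
    _ = _ := by ring

/-- Near `p`, secants of the polyhedral boundary are nearly tangential at `p`: along the segment in
`Δ_r` between their end points, the graph runs through finitely many faces, each of which is nearly
tangential. -/
theorem ChartSystem.IsBound.abs_inner_le_of_mem_boundary {c : ChartSystem Ω} {K L h₀ C σ : ℝ}
    (hK : c.IsBound K) (hL : IsNormalBound Ω L) {𝒯 : Mesh N h} (h𝒯 : 𝒯.IsCompatible c h₀)
    (hσ : 𝒯.IsRegular σ) {r : Fin c.M} {ψ : E (N - 1) → ℝ} (hψ : 𝒯.IsGraphOver c r ψ)
    (hC0 : 0 ≤ C) (hC : ∀ y ∈ ball (0 : E (N - 1)) c.α, |c.φ r y - ψ y| ≤ C * h ^ 2)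
    {p x y : E N} (hp : p ∈ frontier Ω) (hpU : p ∈ c.U r) (hx : x ∈ 𝒯.boundary) (hxU : x ∈ c.U r)
    (hy : y ∈ 𝒯.boundary) (hyU : y ∈ c.U r) (hxp : ‖x - p‖ ≤ C * h ^ 2)
    (hyp : ‖y - p‖ ≤ C * h ^ 2) {ε : ℝ}
    (hε : ε = (N + 1) * (L * ((2 + K) * C + 2) * h * |σ|)) (hε1 : (2 * K + 4) * ε < 1) :
    inner ℝ (outerNormal Ω p) (y - x) ≤ (2 * K + 4) * ε * ‖y - x‖ := by
  have hK0 : 0 < K := zero_lt_one.trans_le hK.one_le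
  have hL0 : 0 < L := zero_lt_one.trans_le hL.one_le
  have hh0 : 0 < h := h𝒯.1
  have hh1 : h < 1 := h𝒯.2.1.trans_le (min_le_right _ _)
  have hε0 : 0 ≤ ε := by rw [hε]; positivity
  set a := (c.A r x).fst with ha
  set b := (c.A r y).fst with hb
  set Y : ℝ → E (N - 1) := fun t => a + t • (b - a) with hY
  set X : ℝ → E N := fun t => chartPoint (c.A r) (Y t) (ψ (Y t)) with hX
  have hYcont : Continuous Y := by fun_prop
  -- `Y t` stays in the intersection of `Δ_r` with a small ball about the projection of `p`
  have hYmem : ∀ t ∈ Icc (0 : ℝ) 1,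
      Y t ∈ ball (0 : E (N - 1)) c.α ∩ closedBall (c.A r p).fst (C * h ^ 2) := by
    intro t ht
    have hconv := (convex_ball (0 : E (N - 1)) c.α).inter
      (convex_closedBall (c.A r p).fst (C * h ^ 2))
    refine hconv.add_smul_sub_mem ⟨hxU.1, ?_⟩ ⟨hyU.1, ?_⟩ ht
    · rw [mem_closedBall, dist_eq_norm]
      exact (norm_fst_chart_sub_le _ _ _).trans hxp
    · rw [mem_closedBall, dist_eq_norm]
      exact (norm_fst_chart_sub_le _ _ _).trans hyp
  have hX0 : X 0 = x := by
    refine eq_of_chart_eq (c.A r) ?_ ?_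
    · simp [hX, hY, ha]
    · rw [hψ.snd_eq hx hxU]; simp [hX, hY, ha]
  have hX1 : X 1 = y := by
    refine eq_of_chart_eq (c.A r) ?_ ?_
    · simp [hX, hY, hb]
    · rw [hψ.snd_eq hy hyU]; simp [hX, hY, hb]
  have hXcont : ContinuousOn X (Icc 0 1) := by
    have h1 : ContinuousOn (fun t => ψ (Y t)) (Icc 0 1) :=
      hψ.1.comp hYcont.continuousOn fun t ht => (hYmem t ht).1
    have h2 : ContinuousOn (fun t => (WithLp.toLp 2 (Y t, ψ (Y t)) : Coord N)) (Icc 0 1) :=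
      (WithLp.prod_continuous_toLp 2 _ _).comp_continuousOn (hYcont.continuousOn.prodMk h1)
    exact (c.A r).symm.continuous.comp_continuousOn h2
  have hXp : ∀ t ∈ Icc (0 : ℝ) 1, ‖p - X t‖ ≤ (2 + K) * C * h := by
    intro t ht
    obtain ⟨h1, h2⟩ := hYmem t ht
    rw [mem_closedBall, dist_eq_norm] at h2
    have h3 := norm_sub_le_chart (c.A r) (X t) p
    simp only [hX, fst_chartPoint, snd_chartPoint] at h3
    rw [(c.mem_frontier_iff r hpU).1 hp] at h3
    have h4 := hC _ h1
    rw [abs_sub_comm] at h4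
    have h5 := hK.abs_sub_le r hpU.1 h1
    have h6 := _root_.abs_sub_le (ψ (Y t)) (c.φ r (Y t)) (c.φ r (c.A r p).fst)
    have h7 : K * ‖Y t - (c.A r p).fst‖ ≤ K * (C * h ^ 2) := by gcongr
    have h8 : (2 + K) * C * h ^ 2 ≤ (2 + K) * C * h := by
      gcongr
      nlinarith
    rw [norm_sub_rev]
    simp only [hX]
    linarith
  -- the faces induce a finite closed cover of the parameter interval
  set F : Finset (E N) → Set ℝ := fun S => Icc 0 1 ∩ X ⁻¹' convexHull ℝ (S : Set (E N)) with hF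
  have hyx : ‖b - a‖ ≤ ‖y - x‖ := norm_fst_chart_sub_le _ _ _
  have hfin := sub_le_of_finite_closed_cover (f := fun t => inner ℝ (outerNormal Ω p) (X t))
    (F := F) (L := (2 * K + 4) * ε * ‖y - x‖) 𝒯.finite_boundaryMesh
    (continuousOn_const.inner hXcont)
    (fun S _ => hXcont.preimage_isClosed_of_isClosed isClosed_Icc
      (isCompact_convexHull_finset S).isClosed)
    (fun t ht => by
      obtain ⟨S, hS, hmem⟩ := 𝒯.mem_boundary.1 (hψ.chartPoint_mem (hYmem t ht).1).1
      exact ⟨S, hS, ht, hmem⟩)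
    (fun S hS s hs t ht hsF htF => ?_)
  · rw [inner_sub_right, ← hX0, ← hX1]
    rw [← hX0, ← hX1] at hfin
    exact hfin
  · have h1 := hL.abs_inner_le_of_mem_face hσ hS (h𝒯.2.2.2 S hS) hh0.le hp
      (by positivity : 0 ≤ (2 + K) * C) hsF.2 htF.2 (hXp s hs)
    rw [← hε] at h1
    have h2 := hK.abs_snd_le r hp hpU (X s) (X t)
    have h3 := norm_sub_le_chart (c.A r) (X s) (X t)
    have h4 : ‖(c.A r (X s)).fst - (c.A r (X t)).fst‖ = |s - t| * ‖b - a‖ := by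
      simp only [hX, fst_chartPoint, hY]
      rw [add_sub_add_left_eq_sub, ← sub_smul, norm_smul, Real.norm_eq_abs]
    rw [h4] at h2 h3
    rw [← inner_sub_right]
    set d := |s - t| * ‖b - a‖
    have hd0 : 0 ≤ d := by positivity
    set i := |inner ℝ (outerNormal Ω p) (X s - X t)|
    set e := |(c.A r (X s)).snd - (c.A r (X t)).snd|
    have he0 : 0 ≤ e := abs_nonneg _
    have h5 : i ≤ ε * (d + e) := h1.trans (by gcongr)
    have h6 : (1 + K) * i ≤ 1 / 2 * (d + e) := by
      calc (1 + K) * i ≤ (1 + K) * (ε * (d + e)) := by gcongr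
        _ = (1 + K) * ε * (d + e) := by ring
        _ ≤ 1 / 2 * (d + e) := by gcongr; linarith
    have h7 : d + e ≤ (2 * K + 4) * d := by linarith
    calc i ≤ ε * ((2 * K + 4) * d) := h5.trans (by gcongr)
      _ = (2 * K + 4) * ε * ‖b - a‖ * |s - t| := by ring
      _ ≤ _ := by gcongr

/-! ### The projection of the polyhedral boundary -/

theorem infDist_le_of_mem_boundary {c : ChartSystem Ω} {h₀ C : ℝ} (hh₀ : c.IsCoverRadius h₀)
    {𝒯 : Mesh N h} (h𝒯 : 𝒯.IsCompatible c h₀)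
    (hC : ∀ (r : Fin c.M) (ψ : E (N - 1) → ℝ), 𝒯.IsGraphOver c r ψ →
      ∀ y ∈ ball (0 : E (N - 1)) c.α, |c.φ r y - ψ y| ≤ C * h ^ 2) {x : E N}
    (hx : x ∈ 𝒯.boundary) : infDist x (frontier Ω) ≤ C * h ^ 2 := by
  obtain ⟨S, hS, hxS⟩ := 𝒯.mem_boundary.1 hx
  obtain ⟨v, hv⟩ := exists_mem_of_mem_convexHull hxS
  obtain ⟨r, hr⟩ := hh₀.2 v (h𝒯.2.2.2 S hS hv)
  have hxU : x ∈ c.U r := hr <| by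
    rw [mem_ball, dist_eq_norm]
    exact (𝒯.norm_sub_le hS hxS (subset_convexHull ℝ _ hv)).trans_lt
      (h𝒯.2.1.trans_le (min_le_left _ _))
  obtain ⟨ψ, hψ⟩ := h𝒯.2.2.1 r
  refine (infDist_le_dist_of_mem (c.chartPoint_mem_frontier r hxU.1)).trans ?_
  rw [dist_eq_norm]
  refine (norm_sub_le_chart (c.A r) _ _).trans ?_
  rw [fst_chartPoint, snd_chartPoint, sub_self, norm_zero, zero_add, hψ.snd_eq hx hxU,
    abs_sub_comm]
  exact hC r ψ hψ _ hxU.1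

/-- Each short normal segment meets the polyhedral boundary: in the chart, its end points are on
different sides of the graph of `ψ`. -/
theorem ChartSystem.IsBound.exists_add_smul_mem_boundary {c : ChartSystem Ω} {K h₀ C : ℝ}
    (hK : c.IsBound K) {𝒯 : Mesh N h} (hC0 : 0 < C)
    {r : Fin c.M} {ψ : E (N - 1) → ℝ} (hψ : 𝒯.IsGraphOver c r ψ)
    (hC : ∀ y ∈ ball (0 : E (N - 1)) c.α, |c.φ r y - ψ y| ≤ C * h ^ 2) {p : E N}
    (hp : p ∈ frontier Ω) (hball : ball p h₀ ⊆ c.U r) (hh1 : 2 * C * h ^ 2 < h₀)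
    (hh2 : 4 * K * C * h ^ 2 ≤ 1) :
    ∃ s : ℝ, |s| ≤ 2 * C * h ^ 2 ∧ p + s • outerNormal Ω p ∈ 𝒯.boundary := by
  have hK0 : 0 < K := zero_lt_one.trans_le hK.one_le
  set s₀ := 2 * C * h ^ 2 with hs₀
  have hs₀0 : 0 ≤ s₀ := by positivity
  have hpU : p ∈ c.U r := hball (mem_ball_self (hs₀0.trans_lt hh1))
  have hn : ‖outerNormal Ω p‖ = 1 := c.norm_outerNormal hp
  set X : ℝ → E N := fun s => p + s • outerNormal Ω p with hX
  have hXc : Continuous X := by fun_prop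
  have hXn : ∀ s, ‖X s - p‖ = |s| := fun s => by
    rw [hX, add_sub_cancel_left, norm_smul, hn, mul_one, Real.norm_eq_abs]
  have hXU : ∀ s ∈ Icc (-s₀) s₀, X s ∈ c.U r := fun s hs => hball <| by
    rw [mem_ball, dist_eq_norm, hXn]
    exact (abs_le.2 hs).trans_lt hh1
  set f : ℝ → ℝ := fun s => (c.A r (X s)).snd - ψ (c.A r (X s)).fst with hf
  have hfc : ContinuousOn f (Icc (-s₀) s₀) :=
    ((continuous_snd_chart _).comp hXc).continuousOn.sub
      (hψ.1.comp ((continuous_fst_chart _).comp hXc).continuousOn fun s hs => (hXU s hs).1)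
  have h1 := one_le_norm_graphNormal (fderiv ℝ (c.φ r) (c.A r p).fst)
  set m := ‖graphNormal (fderiv ℝ (c.φ r) (c.A r p).fst)‖ with hm
  -- along the normal, the height above the graph of `c.φ r` is `-m s` up to a quadratic error
  have hheight : ∀ s ∈ Icc (-s₀) s₀,
      |c.φ r (c.A r (X s)).fst - (c.A r (X s)).snd - m * s| ≤ K * s ^ 2 := by
    intro s hs
    have hI := c.inner_normal r p (X s) p
    rw [← c.outerNormal_eq r hp hpU, hX, add_sub_cancel_left, inner_smul_right,
      real_inner_self_eq_norm_sq, hn, (c.mem_frontier_iff r hpU).1 hp] at hI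
    have hT := hK.taylor r hpU.1 (hXU s hs).1
    have hle : ‖(c.A r (X s)).fst - (c.A r p).fst‖ ^ 2 ≤ s ^ 2 := by
      rw [← sq_abs s, ← hXn s]
      gcongr
      exact norm_fst_chart_sub_le _ _ _
    have e : c.φ r (c.A r (X s)).fst - (c.A r (X s)).snd - m * s =
        c.φ r (c.A r (X s)).fst - c.φ r (c.A r p).fst -
          fderiv ℝ (c.φ r) (c.A r p).fst ((c.A r (X s)).fst - (c.A r p).fst) := by
      simp only [hX]
      linarith
    rw [e]
    exact hT.trans (by gcongr)
  have hquad : K * s₀ ^ 2 ≤ C * h ^ 2 := by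
    calc K * s₀ ^ 2 = 4 * K * C * h ^ 2 * (C * h ^ 2) := by rw [hs₀]; ring
      _ ≤ 1 * (C * h ^ 2) := by gcongr
      _ = C * h ^ 2 := one_mul _
  have hms : s₀ ≤ m * s₀ := le_mul_of_one_le_left hs₀0 h1
  have hr : s₀ ∈ Icc (-s₀) s₀ := ⟨by linarith, le_rfl⟩
  have hl : -s₀ ∈ Icc (-s₀) s₀ := ⟨le_rfl, by linarith⟩
  have hfr : f s₀ ≤ 0 := by
    have h2 := abs_le.1 (hheight s₀ hr)
    have h3 := abs_le.1 (hC _ (hXU s₀ hr).1)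
    simp only [hf]
    linarith [h2.1, h3.2]
  have hfl : 0 ≤ f (-s₀) := by
    have h2 := abs_le.1 (hheight (-s₀) hl)
    have h3 := abs_le.1 (hC _ (hXU (-s₀) hl).1)
    rw [neg_sq] at h2
    simp only [hf]
    linarith [h2.2, h3.1]
  obtain ⟨s, hs, hs0⟩ := intermediate_value_Icc' (by linarith : -s₀ ≤ s₀) hfc ⟨hfr, hfl⟩
  exact ⟨s, abs_le.2 hs, (hψ.2.superset ⟨(hXU s hs).1, sub_eq_zero.1 hs0⟩).1⟩

end BoundaryProjection

end

theorem mainTheorem5 (N : ℕ) (hN : 2 ≤ N) (Ω : Set (BoundaryProjection.E N))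
    (hΩ_open : IsOpen Ω) (hΩ_conn : IsConnected Ω) (hΩ_bdd : Bornology.IsBounded Ω)
    (c : BoundaryProjection.ChartSystem Ω) (h₀ : ℝ) (hh₀ : c.IsCoverRadius h₀) :
    ∃ δ : ℝ, 0 < δ ∧
      (∀ x ∈ BoundaryProjection.tube Ω δ, ∃! p, BoundaryProjection.IsProjection Ω x p) ∧
      (∃ C : ℝ, ∀ σ : ℝ, BoundaryProjection.IsInterpolationConstant c h₀ σ C) ∧
      ∀ σ C : ℝ, BoundaryProjection.IsInterpolationConstant c h₀ σ C →
        ∃ hbar : ℝ, 0 < hbar ∧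
          ∀ (h : ℝ) (𝒯 : BoundaryProjection.Mesh N h),
            𝒯.IsCompatible c h₀ → 𝒯.IsRegular σ → h < hbar →
              𝒯.boundary ⊆ BoundaryProjection.tube Ω δ ∧
              ∃ e : 𝒯.boundary ≃ₜ frontier Ω,
                (∀ x : 𝒯.boundary,
                  (e x : BoundaryProjection.E N) = BoundaryProjection.proj Ω x) ∧
                ∃ t : frontier Ω → ℝ, ∀ x : frontier Ω,
                  (e.symm x : BoundaryProjection.E N) =
                    x + t x • BoundaryProjection.outerNormal Ω x ∧
                  |t x| ≤ 2 * C * h ^ 2 := by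
  open BoundaryProjection Set Metric in
  obtain ⟨K, hK⟩ := c.exists_isBound
  obtain ⟨L, hL⟩ := c.exists_isNormalBound hh₀
  have hK0 : 0 < K := zero_lt_one.trans_le hK.one_le
  have hL0 : 0 < L := zero_lt_one.trans_le hL.one_le
  have hΓc : IsCompact (frontier Ω) := isCompact_frontier_of_isBounded hΩ_bdd
  have hΓ : (frontier Ω).Nonempty :=
    nonempty_frontier_of_isBounded hN hΩ_conn.nonempty hΩ_bdd
  have hproj : ∀ x, IsProjection Ω x (proj Ω x) := fun x =>
    isProjection_proj (c.exists_isProjection hΓc hΓ x)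
  set δ := 1 / (8 * L) with hδ
  have hδ0 : 0 < δ := by positivity
  refine ⟨δ, hδ0, fun x hx => ⟨proj Ω x, hproj x, fun q hq => ?_⟩,
    c.exists_isInterpolationConstant hh₀, fun σ C hσC => ?_⟩
  · exact hL.eq_of_add_smul_eq hq.1 (hproj x).1 (c.norm_outerNormal hq.1)
      (c.norm_outerNormal (hproj x).1) (le_of_lt hx) (le_of_lt hx) (hq.2.symm.trans (hproj x).2)
  obtain ⟨hC0, hC⟩ := hσC
  have hh₀0 := hh₀.1
  set B := (N + 1) * (L * ((2 + K) * C + 2) * |σ|) with hB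
  have hB0 : 0 ≤ B := by positivity
  -- `h < 1 / Q` makes each of the nonnegative terms of `Q`, multiplied by `h`, less than `1`
  set Q := 1 + 2 * C / δ + 2 * C / h₀ + 4 * K * C + (2 * K + 4) * B with hQ
  have hQ0 : 0 < Q := by positivity
  refine ⟨1 / Q, by positivity, fun h 𝒯 h𝒯 hreg hlt => ?_⟩
  have hh0 : 0 < h := h𝒯.1
  have hh1 : h < 1 := h𝒯.2.1.trans_le (min_le_right _ _)
  have hhsq : h ^ 2 ≤ h := by nlinarith
  have hsmall : ∀ a, a ≤ Q → a * h < 1 := fun a ha => by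
    rw [lt_div_iff₀ hQ0] at hlt
    have : a * h ≤ Q * h := by gcongr
    linarith
  have hCδ : 2 * C * h ^ 2 < δ := by
    have h1 := hsmall (2 * C / δ) (by
      have : 0 ≤ 2 * C / h₀ + 4 * K * C + (2 * K + 4) * B := by positivity
      linarith)
    rw [div_mul_eq_mul_div, div_lt_one hδ0] at h1
    exact lt_of_le_of_lt (by gcongr) h1
  have hCh₀ : 2 * C * h ^ 2 < h₀ := by
    have h1 := hsmall (2 * C / h₀) (by
      have : 0 ≤ 2 * C / δ + 4 * K * C + (2 * K + 4) * B := by positivity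
      linarith)
    rw [div_mul_eq_mul_div, div_lt_one hh₀0] at h1
    exact lt_of_le_of_lt (by gcongr) h1
  have hCK : 4 * K * C * h ^ 2 ≤ 1 := by
    have h1 := hsmall (4 * K * C) (by
      have : 0 ≤ 2 * C / δ + 2 * C / h₀ + (2 * K + 4) * B := by positivity
      linarith)
    exact le_trans (by gcongr) h1.le
  have hBh : (2 * K + 4) * (B * h) < 1 := by
    have h1 := hsmall ((2 * K + 4) * B) (by
      have : 0 ≤ 2 * C / δ + 2 * C / h₀ + 4 * K * C := by positivity
      linarith)
    rwa [mul_assoc] at h1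
  have hCh0 : 0 ≤ C * h ^ 2 := by positivity
  have hdist : ∀ x ∈ 𝒯.boundary, |signedDist Ω x| ≤ C * h ^ 2 := fun x hx => by
    rw [abs_signedDist]
    exact infDist_le_of_mem_boundary hh₀ h𝒯 (hC h 𝒯 h𝒯 hreg) hx
  have htube : 𝒯.boundary ⊆ tube Ω δ := fun x hx =>
    (hdist x hx).trans_lt (by linarith)
  refine ⟨htube, ?_⟩
  -- distance from a point to its foot point
  have hfoot : ∀ x ∈ 𝒯.boundary, ‖x - proj Ω x‖ ≤ C * h ^ 2 := fun x hx => by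
    nth_rewrite 1 [(hproj x).2]
    rw [add_sub_cancel_left, norm_smul, c.norm_outerNormal (hproj x).1, mul_one]
    exact hdist x hx
  let f : 𝒯.boundary → frontier Ω := fun x => ⟨proj Ω x, (hproj x).1⟩
  have hfcont : Continuous f := by
    refine (LipschitzWith.of_dist_le_mul (K := 3) fun x y => ?_).continuous
    rw [Subtype.dist_eq, Subtype.dist_eq, dist_eq_norm, dist_eq_norm]
    exact hL.norm_sub_le_of_isProjection (hproj x) (hproj y)
      (c.norm_outerNormal (hproj x).1) (htube y.2)
  have hsurj : Function.Surjective f := by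
    rintro ⟨p, hp⟩
    obtain ⟨r, hr⟩ := hh₀.2 p hp
    obtain ⟨ψ, hψ⟩ := h𝒯.2.2.1 r
    obtain ⟨s, hs, hmem⟩ := hK.exists_add_smul_mem_boundary hC0 hψ
      (hC h 𝒯 h𝒯 hreg r ψ hψ) hp hr hCh₀ hCK
    refine ⟨⟨_, hmem⟩, Subtype.ext ?_⟩
    have hpr := hproj (p + s • outerNormal Ω p)
    exact (hL.eq_of_add_smul_eq hp hpr.1 (c.norm_outerNormal hp) (c.norm_outerNormal hpr.1)
      (hs.trans hCδ.le) (le_of_lt (htube hmem)) hpr.2).symm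
  have hinj : Function.Injective f := by
    rintro ⟨x, hx⟩ ⟨y, hy⟩ hxy
    have hxy' : proj Ω x = proj Ω y := congrArg Subtype.val hxy
    have hp := (hproj x).1
    have hxn := (hproj x).2
    have hyn := (hproj y).2
    have hxp := hfoot x hx
    have hyp := hfoot y hy
    rw [← hxy'] at hyn hyp
    set p := proj Ω x
    obtain ⟨r, hr⟩ := hh₀.2 p hp
    obtain ⟨ψ, hψ⟩ := h𝒯.2.2.1 r
    have hCr := hC h 𝒯 h𝒯 hreg r ψ hψ
    have hxU : x ∈ c.U r := hr (by rw [mem_ball, dist_eq_norm]; linarith)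
    have hyU : y ∈ c.U r := hr (by rw [mem_ball, dist_eq_norm]; linarith)
    have hpU : p ∈ c.U r := hr (mem_ball_self hh₀0)
    have hε : B * h = (N + 1) * (L * ((2 + K) * C + 2) * h * |σ|) := by rw [hB]; ring
    have h1 := hK.abs_inner_le_of_mem_boundary hL h𝒯 hreg hψ hC0.le hCr hp hpU hx hxU hy hyU
      hxp hyp hε hBh
    have h2 := hK.abs_inner_le_of_mem_boundary hL h𝒯 hreg hψ hC0.le hCr hp hpU hy hyU hx hxU
      hyp hxp hε hBh
    -- the secant from `x` to `y` is itself normal at `p`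
    have hsec : y - x = (signedDist Ω y - signedDist Ω x) • outerNormal Ω p := by
      rw [sub_smul]
      nth_rewrite 1 [hyn, hxn]
      abel
    have hnorm : ‖y - x‖ = |signedDist Ω y - signedDist Ω x| := by
      rw [hsec, norm_smul, c.norm_outerNormal hp, mul_one, Real.norm_eq_abs]
    have hin : inner ℝ (outerNormal Ω p) (y - x) = signedDist Ω y - signedDist Ω x := by
      rw [hsec, inner_smul_right, real_inner_self_eq_norm_sq, c.norm_outerNormal hp]; ring
    have hin' : inner ℝ (outerNormal Ω p) (x - y) = -(signedDist Ω y - signedDist Ω x) := by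
      rw [← neg_sub y x, inner_neg_right, hin]
    rw [norm_sub_rev x y, hin'] at h2
    rw [hin] at h1
    have h3 : ‖y - x‖ ≤ (2 * K + 4) * (B * h) * ‖y - x‖ := by
      nth_rewrite 1 [hnorm]
      exact abs_le'.2 ⟨h1, h2⟩
    have h4 : ‖y - x‖ ≤ 0 := by
      by_contra! hpos
      nlinarith
    exact Subtype.ext (sub_eq_zero.1 (norm_le_zero_iff.1 h4)).symm
  have : CompactSpace 𝒯.boundary := isCompact_iff_compactSpace.1 𝒯.isCompact_boundary
  let e : 𝒯.boundary ≃ₜ frontier Ω :=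
    Continuous.homeoOfEquivCompactToT2 (f := Equiv.ofBijective f ⟨hinj, hsurj⟩) hfcont
  have he : ∀ x, (e x : E N) = proj Ω x := fun x => rfl
  refine ⟨e, he, fun x => signedDist Ω (e.symm x), fun x => ⟨?_, ?_⟩⟩
  · have h1 := (hproj (e.symm x)).2
    rwa [← he, e.apply_symm_apply] at h1
  · have h1 := hdist _ (e.symm x).2
    linarith
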